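/- Let $Q$ be a smooth finite-dimensional (Hausdorff) manifold without boundary and let $l:TQ\to\mathbb R$ be a smooth, possibly degenerate, Lagrangian. Let $\mathscr L:TQ\to T^*Q$ be its Legendre transformation (the fibre derivative of $l$) and $e(v)=\langle\mathscr L(v),v\rangle-l(v)$ its energy. Let $\omega=d\vartheta_0$ be the canonical symplectic form of $T^*Q$, where $\vartheta_0$ is the tautological one-form. The Hamiltonian vector field $X_f$ of $f\in C^\infty(T^*Q)$ is defined by $\omega(X_f,\cdot)=-df$. Assume that the primary constraint set $\mathscr P=\mathscr L(TQ)$ is a closed embedded submanifold of $T^*Q$ and that $\mathscr L$ is a submersion of $TQ$ onto $\mathscr P$. Let $h\in C^\infty(T^*Q)$ be a Hamiltonian of the theory, that is, any smooth function with $h\circ\mathscr L=e$. Let $\mathcal P\subset C^\infty(T^*Q)$ be the ideal of primary constraints, i.e. of the smooth functions that vanish on $\mathscr P$, and let $p_1,\dots,p_k$ be generators of $\mathcal P$. Let $J\subseteq\mathbb R$ be open (for instance an open interval, or $J=\mathbb R$) and let $\gamma:J\to Q$ be a smooth curve whose first jet $j^1\gamma(t)=\dot\gamma(t)$ satisfies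 the Euler–Lagrange equations of $l$, which in local coordinates read $\frac{d}{dt}\frac{\partial l}{\partial \dot x}=\frac{\partial l}{\partial x}$. Then there are smooth functions $\lambda_1,\dots,\lambda_k:J\to\mathbb R$ (Lagrange multipliers) such that $t\mapsto\mathscr L j^1\gamma(t)$ is an integral curve of the (time-dependent) Hamiltonian vector field of the total Hamiltonian $h+\sum_{i=1}^k\lambda_i p_i$, that is, $$\frac{d}{dt}\,\mathscr L j^1\gamma(t)=X_{h+\sum_i\lambda_i(t)p_i}\bigl(\mathscr L j^1\gamma(t)\bigr)\qquad\text{for all } t\in J .$$ -/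

import Mathlib

open Set Filter Topology
open scoped Manifold ContDiff

noncomputable section

namespace DiracConstraint

/-! ### Submanifolds, submersions and one-forms on a manifold without boundary -/

section Manifold

variable {EM : Type*} [NormedAddCommGroup EM] [NormedSpace ℝ EM]
  {HM : Type*} [TopologicalSpace HM] (I : ModelWithCorners ℝ EM HM)
  {M : Type*} [TopologicalSpace M] [ChartedSpace HM M]

/-- `S` is an embedded submanifold of `M`: near each of its points, `S` is the preimage of a linear
subspace of the model space under a smooth chart of `M`. -/
def IsEmbeddedSubmanifold (S : Set M) : Prop :=
  ∀ x ∈ S, ∃ φ ∈ IsManifold.maximalAtlas I ∞ M, x ∈ φ.source ∧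
    ∃ F : Submodule ℝ EM, ∀ y ∈ φ.source, y ∈ S ↔ φ.extend I y ∈ F

/-- `u` is tangent at `x` to the subset `S` of `M`: it is the velocity at `x` of a smooth curve
lying in `S`. If `S` is an embedded submanifold, these vectors form its tangent space `T_x S`. -/
def IsTangentTo (S : Set M) (x : M) (u : TangentSpace I x) : Prop :=
  ∃ c : ℝ → M, c 0 = x ∧ (∀ᶠ s in 𝓝 (0 : ℝ), c s ∈ S) ∧ ContMDiffAt 𝓘(ℝ, ℝ) I ∞ c 0 ∧
    (mfderiv 𝓘(ℝ, ℝ) I c 0 (1 : ℝ) : EM) = u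

/-- The exterior derivative of a one-form `θ` on `M`, as a function of a point `x` and two tangent
vectors at `x`. With `φ` a chart at `x`, it is the pull-back under `φ` of the exterior derivative
`(a, b) ↦ (D_a θ') b - (D_b θ') a` of the local representative `θ' = (φ⁻¹)^* θ`. -/
def extDerivOneForm (θ : ∀ x : M, TangentSpace I x →L[ℝ] ℝ) (x : M) (u w : TangentSpace I x) : ℝ :=
  let θ' : EM → EM →L[ℝ] ℝ := fun y =>
    (θ ((extChartAt I x).symm y)).comp (mfderiv 𝓘(ℝ, EM) I (extChartAt I x).symm y)
  let a : EM := mfderiv I 𝓘(ℝ, EM) (extChartAt I x) x u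
  let b : EM := mfderiv I 𝓘(ℝ, EM) (extChartAt I x) x w
  fderiv ℝ θ' (extChartAt I x x) a b - fderiv ℝ θ' (extChartAt I x x) b a

/-- `c` is, on `J`, an integral curve of the time-dependent vector field `X` on `M`. -/
def IsTimeDepIntegralCurveOn (c : ℝ → M) (X : ℝ → ∀ x : M, TangentSpace I x) (J : Set ℝ) : Prop :=
  ∀ t ∈ J, HasMFDerivAt 𝓘(ℝ, ℝ) I c t ((1 : ℝ →L[ℝ] ℝ).smulRight (X t (c t)))

end Manifold

/-! ### The cotangent bundle and its symplectic form -/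

section Cotangent

variable (E : Type*) [NormedAddCommGroup E] [NormedSpace ℝ E]
  (Q : Type*) [TopologicalSpace Q] [ChartedSpace E Q] [IsManifold 𝓘(ℝ, E) ∞ Q]

/-- The cotangent bundle `T*Q`, as Mathlib's vector bundle of continuous linear maps from the
tangent bundle of `Q` to the trivial line bundle. -/
abbrev CotangentBundle : Type _ :=
  Bundle.TotalSpace (E →L[ℝ] ℝ)
    (fun q : Q => TangentSpace 𝓘(ℝ, E) q →L[ℝ] Bundle.Trivial Q ℝ q)

/-- The model with corners of `T*Q`. -/
abbrev cotangentModel : ModelWithCorners ℝ (E × (E →L[ℝ] ℝ)) (ModelProd E (E →L[ℝ] ℝ)) :=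
  𝓘(ℝ, E).prod 𝓘(ℝ, E →L[ℝ] ℝ)

variable {E Q}

/-- The tautological (Liouville) one-form `ϑ₀` on `T*Q`: `ϑ₀(ξ)(u) = ξ (dπ u)`. -/
def canonicalOneForm (ξ : CotangentBundle E Q) :
    TangentSpace (cotangentModel E) ξ →L[ℝ] ℝ :=
  (show TangentSpace 𝓘(ℝ, E) ξ.proj →L[ℝ] ℝ from ξ.snd).comp
    (mfderiv (cotangentModel E) 𝓘(ℝ, E)
      (fun η : CotangentBundle E Q => η.proj) ξ)

/-- The canonical symplectic form `ω = dϑ₀` of `T*Q`; in canonical coordinates `dp ∧ dq`. -/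
def symplecticForm (ξ : CotangentBundle E Q) (u w : TangentSpace (cotangentModel E) ξ) : ℝ :=
  extDerivOneForm (cotangentModel E) (canonicalOneForm (E := E) (Q := Q)) ξ u w

/-- The ring `C^∞(T*Q)` of smooth real functions on `T*Q`. -/
abbrev SmoothFunctions (E : Type*) [NormedAddCommGroup E] [NormedSpace ℝ E]
    (Q : Type*) [TopologicalSpace Q] [ChartedSpace E Q] [IsManifold 𝓘(ℝ, E) ∞ Q] : Type _ :=
  C^∞⟮cotangentModel E, CotangentBundle E Q; 𝓘(ℝ, ℝ), ℝ⟯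

/-- `X` is the Hamiltonian vector field of `f`: `X ⌟ ω = -df`. -/
def IsHamiltonianVectorField (f : SmoothFunctions E Q)
    (X : ∀ ξ : CotangentBundle E Q, TangentSpace (cotangentModel E) ξ) : Prop :=
  ∀ (ξ : CotangentBundle E Q) (w : TangentSpace (cotangentModel E) ξ),
    symplecticForm ξ (X ξ) w = -(mfderiv (cotangentModel E) 𝓘(ℝ, ℝ) f ξ w : ℝ)

end Cotangent

/-! ### Lagrangian mechanics -/

section Lagrangian

variable {E : Type*} [NormedAddCommGroup E] [NormedSpace ℝ E]
  {Q : Type*} [TopologicalSpace Q] [ChartedSpace E Q] [IsManifold 𝓘(ℝ, E) ∞ Q]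

/-- The Legendre transformation `TQ → T*Q` of `l`: the derivative of `l` along the fibres of `TQ`. -/
def legendre (l : TangentBundle 𝓘(ℝ, E) Q → ℝ) (v : TangentBundle 𝓘(ℝ, E) Q) :
    CotangentBundle E Q :=
  ⟨v.proj, fderiv ℝ (fun w : E => l ⟨v.proj, w⟩) v.snd⟩

/-- The energy `e(v) = ⟨𝓛(v), v⟩ - l(v)` of the Lagrangian `l`. -/
def energy (l : TangentBundle 𝓘(ℝ, E) Q → ℝ) (v : TangentBundle 𝓘(ℝ, E) Q) : ℝ :=
  (legendre l v).snd v.snd - l v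

/-- The first jet extension `t ↦ γ'(t)` of a curve `γ` in `Q`, a curve in `TQ`. -/
def firstJet (γ : ℝ → Q) (t : ℝ) : TangentBundle 𝓘(ℝ, E) Q :=
  ⟨γ t, mfderiv 𝓘(ℝ, ℝ) 𝓘(ℝ, E) γ t (1 : ℝ)⟩

/-- The Lagrangian `l` in the coordinates of the chart `φ` of `Q` at `q₀`:
`L(x, v) = l(d(φ⁻¹)_x v)`. -/
def localLagrangian (l : TangentBundle 𝓘(ℝ, E) Q → ℝ) (q₀ : Q) (x v : E) : ℝ :=
  l ⟨(extChartAt 𝓘(ℝ, E) q₀).symm x,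
    mfderiv 𝓘(ℝ, E) 𝓘(ℝ, E) (extChartAt 𝓘(ℝ, E) q₀).symm x v⟩

/-- The curve `γ` satisfies the Euler-Lagrange equations of `l` at all times in `J`: in local
coordinates, `d/dt (∂L/∂v (x(t), x'(t))) = ∂L/∂x (x(t), x'(t))`. -/
def SatisfiesEulerLagrangeOn (l : TangentBundle 𝓘(ℝ, E) Q → ℝ) (γ : ℝ → Q) (J : Set ℝ) : Prop :=
  ∀ t ∈ J, ∀ q₀ : Q, γ t ∈ (chartAt E q₀).source →
    let x : ℝ → E := fun s => extChartAt 𝓘(ℝ, E) q₀ (γ s)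
    HasDerivAt (fun s => fderiv ℝ (fun v => localLagrangian l q₀ (x s) v) (deriv x s))
      (fderiv ℝ (fun y => localLagrangian l q₀ y (deriv x t)) (x t)) t

/-- The primary constraint set `𝒫 = 𝓛(TQ)`. -/
def primaryConstraintSet (l : TangentBundle 𝓘(ℝ, E) Q → ℝ) : Set (CotangentBundle E Q) :=
  Set.range (legendre l)

/-- `𝓛` is a submersion of `TQ` onto `𝒫 = 𝓛(TQ)`: each vector tangent to `𝒫` at `𝓛(v)` is
the image of a vector tangent to `TQ` at `v`. -/
def IsLegendreSubmersion (l : TangentBundle 𝓘(ℝ, E) Q → ℝ) : Prop :=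
  ∀ (v : TangentBundle 𝓘(ℝ, E) Q) (u : TangentSpace (cotangentModel E) (legendre l v)),
    IsTangentTo (cotangentModel E) (primaryConstraintSet l) (legendre l v) u →
      ∃ w : TangentSpace 𝓘(ℝ, E).tangent v,
        mfderiv 𝓘(ℝ, E).tangent (cotangentModel E) (legendre l) v w = u

/-- The ideal of primary constraints: the smooth functions on `T*Q` that vanish on `𝒫`. -/
def primaryConstraints (l : TangentBundle 𝓘(ℝ, E) Q → ℝ) : Ideal (SmoothFunctions E Q) where
  carrier := {f | ∀ ξ ∈ primaryConstraintSet l, f ξ = 0}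
  zero_mem' := fun _ _ => rfl
  add_mem' := by
    intro f g hf hg ξ hξ
    simp [hf ξ hξ, hg ξ hξ]
  smul_mem' := by
    intro c f hf ξ hξ
    simp [hf ξ hξ]

end Lagrangian

end DiracConstraint

end

noncomputable section

namespace DiracConstraint

/-! ### Local Lagrange multipliers on an embedded submanifold -/

section Multipliers

variable {EM : Type*} [NormedAddCommGroup EM] [NormedSpace ℝ EM]
  {HM : Type*} [TopologicalSpace HM] {I : ModelWithCorners ℝ EM HM}
  {M : Type*} [TopologicalSpace M] [ChartedSpace HM M]

/-! Extend the velocity `γ'(t)` to the vector field `V` that is constant in a fixed chart, and put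
`G(ξ) = ⟨ξ, V⟩ - l(V) - h(ξ)` on `T*Q`. Since `h ∘ 𝓛 = e`, the pull-back is `G(𝓛(v)) = ⟨𝓛(v), V - v⟩
- l(V) + l(v)`. It is critical at `v = γ'(t)`, because `𝓛` is the fibre derivative of `l`. As `𝓛` is
a submersion onto `𝒫`, `dG` kills all vectors tangent to `𝒫` at `𝓛(γ'(t))`
(`differential_pairing_sub_eq_zero`).

In a chart adapted to `𝒫`, such a covector is a combination of differentials of linear functions
vanishing on `𝒫`. Cut off, these functions lie in the ideal of constraints, so `dG = ∑ λ_i dp_i`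
with `λ_i` smooth in `t` locally (`exists_multipliers_near`). The admissible multipliers at each
time form an affine set, so a partition of unity patches the local choices
(`exists_contDiffOn_forall_mem_convex`).

On the other hand, `d(⟨ξ, V⟩ - l(V))` at `𝓛(γ'(t))` is `-ω(u, ·)` with `u = (x', ∂L/∂x)` in
coordinates (`differential_pairing`, `symplecticForm_eq`). Hence `ω(u, ·) = -d(h + ∑ λ_i p_i)`. The
Euler-Lagrange equations enter only to say that `u` is the velocity of `t ↦ 𝓛(γ'(t))`
(`hasMFDerivAt_legendre_firstJet`). -/

variable (I) in
/-- The differential of a real function, with values in the dual of the model space. -/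
def differential (f : M → ℝ) (x : M) : EM →L[ℝ] ℝ := mfderiv I 𝓘(ℝ, ℝ) f x

/-- A function which is smooth on an open set `U` agrees near a given point of `U` with a global
smooth function that vanishes off `U` and wherever the given function vanishes. -/
theorem exists_contMDiffMap_eventuallyEq [FiniteDimensional ℝ EM] [IsManifold I ∞ M] [T2Space M]
    {U : Set M} (hU : IsOpen U) {f : M → ℝ}
    (hf : ContMDiffOn I 𝓘(ℝ, ℝ) ∞ f U) {x : M} (hx : x ∈ U) :
    ∃ g : C^∞⟮I, M; 𝓘(ℝ, ℝ), ℝ⟯, (g : M → ℝ) =ᶠ[𝓝 x] f ∧ ∀ y, (y ∈ U → f y = 0) → g y = 0 := by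
  -- The global function is `ρ * f`, with `ρ` a bump function at `x` whose closed support lies in
  -- `U`.
  obtain ⟨ρ, -, hρ⟩ := (SmoothBumpFunction.nhds_basis_tsupport (I := I) x).mem_iff.1
    (hU.mem_nhds hx)
  have hsm : ContMDiff I 𝓘(ℝ, ℝ) ∞ (fun y => ρ y * f y) := by
    refine contMDiff_of_tsupport fun y hy => ?_
    have hyU : y ∈ U := hρ (closure_mono (fun z hz => left_ne_zero_of_mul hz) hy)
    exact ρ.contMDiff.contMDiffAt.mul (hf.contMDiffAt (hU.mem_nhds hyU))
  refine ⟨⟨_, hsm⟩, ?_, fun y hy => ?_⟩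
  · filter_upwards [ρ.eventuallyEq_one] with y hy
    simp [hy]
  · by_cases hyU : y ∈ U
    · simp [hy hyU]
    · have : ρ y = 0 := by
        by_contra h
        exact hyU (hρ (subset_tsupport _ h))
      simp [this]

/-- If the smooth functions `p i` vanish at `x`, the derivative of `∑ a i * p i` at `x` is
`∑ a i x • d(p i)`. -/
theorem differential_sum_mul_of_eq_zero {k : ℕ} (a p : Fin k → M → ℝ) {x : M}
    (ha : ∀ i, MDifferentiableAt I 𝓘(ℝ, ℝ) (a i) x) (hp : ∀ i, MDifferentiableAt I 𝓘(ℝ, ℝ) (p i) x)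
    (h0 : ∀ i, p i x = 0) (w : EM) :
    differential I (fun y => ∑ i, a i y * p i y) x w =
      ∑ i, a i x * differential I (p i) x w := by
  have h1 : HasMFDerivAt I 𝓘(ℝ, ℝ) (∑ i, a i * p i) x
      (∑ i, (a i x • differential I (p i) x + p i x • differential I (a i) x) : EM →L[ℝ] ℝ) :=
    HasMFDerivAt.sum (t := Finset.univ) (z := x) (f := fun i => a i * p i)
      (f' := fun i => (a i x • differential I (p i) x + p i x • differential I (a i) x :
        EM →L[ℝ] ℝ)) fun i _ => (ha i).hasMFDerivAt.mul (hp i).hasMFDerivAt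
  have h2 : (∑ i, a i * p i) = fun y => ∑ i, a i y * p i y := by
    ext y; simp
  rw [h2] at h1
  have h3 : differential I (fun y => ∑ i, a i y * p i y) x = _ := h1.mfderiv
  rw [h3]
  simp [h0]

/-- In the chart `φ` adapted to `S`, the vectors of the subspace `F` are tangent to `S`. -/
theorem fderiv_comp_extend_symm_eq_zero [I.Boundaryless] {S : Set M}
    {φ : OpenPartialHomeomorph M HM} (hφ : φ ∈ IsManifold.maximalAtlas I ∞ M)
    {F : Submodule ℝ EM} (hF : ∀ y ∈ φ.source, y ∈ S ↔ φ.extend I y ∈ F) {x : M}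
    (hx : x ∈ φ.source) (hxS : x ∈ S) {G : M → ℝ} (hG : MDifferentiableAt I 𝓘(ℝ, ℝ) G x)
    (hGS : ∀ u : EM, IsTangentTo I S x u → differential I G x u = 0)
    {v : EM} (hv : v ∈ F) :
    fderiv ℝ (fun y => G ((φ.extend I).symm y)) (φ.extend I x) v = 0 := by
  set e := φ.extend I with he
  have hxe : x ∈ e.source := by rwa [he, φ.extend_source]
  have htgt : e.target ∈ 𝓝 (e x) := by
    rw [he]
    exact (φ.isOpen_extend_target).mem_nhds (e.map_source hxe)
  have hsymm : ContMDiffAt 𝓘(ℝ, EM) I ∞ e.symm (e x) :=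
    (contMDiffOn_extend_symm hφ).contMDiffAt
      (by rwa [← φ.extend_target'])
  -- A straight line in direction `v ∈ F`, pulled back by the adapted chart, stays in `S` for small
  -- `s`; it is the curve that makes its velocity tangent to `S`.
  let c : ℝ → M := fun s => e.symm (e x + s • v)
  have hline : ContDiff ℝ ∞ (fun s : ℝ => e x + s • v) := by fun_prop
  have hc0 : c 0 = x := by simp [c, e.left_inv hxe]
  have hcs : ContMDiffAt 𝓘(ℝ, ℝ) I ∞ c 0 := by
    refine ContMDiffAt.comp (g := e.symm) (0 : ℝ) ?_ hline.contMDiff.contMDiffAt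
    simpa using hsymm
  have hcS : ∀ᶠ s in 𝓝 (0 : ℝ), c s ∈ S := by
    have : ∀ᶠ s in 𝓝 (0 : ℝ), e x + s • v ∈ e.target :=
      hline.continuous.continuousAt.eventually_mem (by simpa using htgt)
    filter_upwards [this] with s hs
    have hs' : c s ∈ φ.source := by rw [← φ.extend_source (I := I)]; exact e.map_target hs
    rw [hF _ hs', e.right_inv hs]
    exact F.add_mem ((hF x hx).1 hxS) (F.smul_mem s hv)
  have hcd : HasMFDerivAt 𝓘(ℝ, ℝ) I c 0 (mfderiv 𝓘(ℝ, ℝ) I c 0) :=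
    (hcs.mdifferentiableAt (by simp)).hasMFDerivAt
  have hG' : MDifferentiableAt I 𝓘(ℝ, ℝ) G (c 0) := by rwa [hc0]
  have h1 : HasFDerivAt (G ∘ c)
      ((differential I G (c 0)).comp (mfderiv 𝓘(ℝ, ℝ) I c 0 : ℝ →L[ℝ] EM)) 0 :=
    hasMFDerivAt_iff_hasFDerivAt.1 (hG'.hasMFDerivAt.comp 0 hcd)
  have h2 : DifferentiableAt ℝ (fun y => G (e.symm y)) (e x) := by
    rw [← mdifferentiableAt_iff_differentiableAt]
    refine MDifferentiableAt.comp (g := G) (e x) ?_ (hsymm.mdifferentiableAt (by simp))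
    rwa [e.left_inv hxe]
  have h3 : HasDerivAt (G ∘ c) (fderiv ℝ (fun y => G (e.symm y)) (e x) v) 0 := by
    have hl : HasDerivAt (fun s : ℝ => e x + s • v) v 0 := by
      simpa using ((hasDerivAt_id (0 : ℝ)).smul_const v).const_add (e x)
    have h2' : HasFDerivAt (fun y => G (e.symm y)) (fderiv ℝ (fun y => G (e.symm y)) (e x))
      (e x + (0 : ℝ) • v) := by simpa using h2.hasFDerivAt
    exact h2'.comp_hasDerivAt (0 : ℝ) hl
  have h4 := h1.hasDerivAt.unique h3
  let u : EM := mfderiv 𝓘(ℝ, ℝ) I c 0 (1 : ℝ)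
  have h5 : differential I G (c 0) u = fderiv ℝ (fun y => G (e.symm y)) (e x) v :=
    h4
  rw [← h5, hc0]
  exact hGS u ⟨c, hc0, hcS, hcs, rfl⟩

/-- The chain rule for a function that factors through a chart `φ`. -/
theorem differential_eq_fderiv_comp [I.Boundaryless]
    {φ : OpenPartialHomeomorph M HM} (hφ : φ ∈ IsManifold.maximalAtlas I ∞ M) {x : M}
    (hx : x ∈ φ.source) {G : M → ℝ} {L : EM → ℝ} (hL : DifferentiableAt ℝ L (φ.extend I x))
    (hGL : G =ᶠ[𝓝 x] fun y => L (φ.extend I y)) (w : EM) :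
    differential I G x w = fderiv ℝ L (φ.extend I x)
      ((mfderiv I 𝓘(ℝ, EM) (φ.extend I) x : EM →L[ℝ] EM) w) := by
  have he : MDifferentiableAt I 𝓘(ℝ, EM) (φ.extend I) x :=
    (((φ.contMDiffOn_extend hφ).contMDiffAt (φ.open_source.mem_nhds hx)).mdifferentiableAt
      (by simp))
  have h1 : HasMFDerivAt I 𝓘(ℝ, ℝ) (L ∘ φ.extend I) x _ :=
    hL.hasFDerivAt.hasMFDerivAt.comp x he.hasMFDerivAt
  have h2 := (h1.congr_of_eventuallyEq hGL).mfderiv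
  exact congrArg (fun A : EM →L[ℝ] ℝ => A w) h2

/-- Lagrange multipliers along a curve `c` in an embedded submanifold `S` whose ideal is generated
by `p`: if the differential of `G t` at `c t` vanishes on the vectors tangent to `S`, it is near
`t₀` a combination of the differentials of the `p i` with smooth coefficients. -/
theorem exists_multipliers_near [FiniteDimensional ℝ EM] [IsManifold I ∞ M] [T2Space M]
    [I.Boundaryless] {S : Set M} (hS : IsEmbeddedSubmanifold I S) {k : ℕ}
    (p : Fin k → C^∞⟮I, M; 𝓘(ℝ, ℝ), ℝ⟯) (hp0 : ∀ i, ∀ x ∈ S, p i x = 0)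
    (hp : ∀ g : C^∞⟮I, M; 𝓘(ℝ, ℝ), ℝ⟯, (∀ x ∈ S, g x = 0) → g ∈ Ideal.span (range p))
    {c : ℝ → M} (hcS : ∀ t, c t ∈ S) {t₀ : ℝ}
    (hc : ∀ᶠ t in 𝓝 t₀, ContMDiffAt 𝓘(ℝ, ℝ) I ∞ c t) (G : ℝ → M → ℝ)
    (hG : ∀ᶠ t in 𝓝 t₀,
      ContMDiffAt (𝓘(ℝ, ℝ).prod I) 𝓘(ℝ, ℝ) ∞ (fun q : ℝ × M => G q.1 q.2) (t, c t))
    (hGS : ∀ᶠ t in 𝓝 t₀, ∀ u : EM, IsTangentTo I S (c t) u → differential I (G t) (c t) u = 0) :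
    ∃ lam : ℝ → Fin k → ℝ, ∀ᶠ t in 𝓝 t₀, ContDiffAt ℝ ∞ lam t ∧ ∀ w : EM,
      differential I (G t) (c t) w = ∑ i, lam t i * differential I (p i) (c t) w := by
  obtain ⟨φ, hφ, hxφ, F, hF⟩ := hS (c t₀) (hcS t₀)
  set e := φ.extend I with he
  have hesm : ContMDiffOn I 𝓘(ℝ, EM) ∞ e φ.source := φ.contMDiffOn_extend hφ
  -- linear coordinates vanishing on `F`
  obtain ⟨P, hP⟩ := Submodule.ClosedComplemented.of_finiteDimensional F
  let N : EM →L[ℝ] EM := ContinuousLinearMap.id ℝ EM - F.subtypeL.comp P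
  have hNF : ∀ v ∈ F, N v = 0 := fun v hv => by simp [N, hP ⟨v, hv⟩]
  have hN : ∀ v, v - N v ∈ F := fun v => by simp [N]
  let b := Module.finBasis ℝ EM
  let ℓ : Fin (Module.finrank ℝ EM) → EM →L[ℝ] ℝ := fun j =>
    (LinearMap.toContinuousLinearMap (b.coord j)).comp N
  have hℓ : ∀ v, N v = ∑ j, ℓ j v • b j := fun v => (b.sum_repr (N v)).symm
  -- Cut off to a global function, `ℓ j ∘ e` vanishes on all of `S`, so it is a combination of the
  -- generators `p i`.
  have hgj : ∀ j, ∃ g : C^∞⟮I, M; 𝓘(ℝ, ℝ), ℝ⟯, (g : M → ℝ) =ᶠ[𝓝 (c t₀)] (fun y => ℓ j (e y)) ∧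
      ∃ a : Fin k → C^∞⟮I, M; 𝓘(ℝ, ℝ), ℝ⟯, ∑ i, a i * p i = g := fun j => by
    obtain ⟨g, hg, hg0⟩ := exists_contMDiffMap_eventuallyEq φ.open_source
      (f := fun y => ℓ j (e y)) ((ℓ j).contDiff.contMDiff.comp_contMDiffOn hesm) hxφ
    refine ⟨g, hg, Ideal.mem_span_range_iff_exists_fun.1 (hp g fun x hx => hg0 x fun hxU => ?_)⟩
    simp [ℓ, hNF _ ((hF x hxU).1 hx)]
  choose g hg a ha using hgj
  -- the local representative of `G` and its differential along the curve
  refine ⟨fun t i => ∑ j, fderiv ℝ (fun y => G t (e.symm y)) (e (c t)) (b j) * a j i (c t), ?_⟩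
  filter_upwards [hGS, hc.self_of_nhds.continuousAt.eventually_mem (φ.open_source.mem_nhds hxφ),
    hc, hG, hc.self_of_nhds.continuousAt.eventually
      (eventually_all.2 fun j => (hg j).eventually_nhds)] with t ht hts hct hGt hgt
  have hte : c t ∈ e.source := by rwa [he, φ.extend_source]
  have hsymm : ContMDiffAt 𝓘(ℝ, EM) I ∞ e.symm (e (c t)) := by
    refine (contMDiffOn_extend_symm hφ).contMDiffAt ?_
    rw [← φ.extend_target']
    exact φ.isOpen_extend_target.mem_nhds (e.map_source hte)
  have hGe : ContDiffAt ℝ ∞ (fun q : ℝ × EM => G q.1 (e.symm q.2)) (t, e (c t)) := by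
    have h1 : ContMDiffAt (𝓘(ℝ, ℝ).prod 𝓘(ℝ, EM)) 𝓘(ℝ, ℝ) ∞
        (fun q : ℝ × EM => G q.1 (e.symm q.2)) (t, e (c t)) := by
      have h2 : ContMDiffAt (𝓘(ℝ, ℝ).prod I) 𝓘(ℝ, ℝ) ∞ (fun q : ℝ × M => G q.1 q.2)
          ((fun q : ℝ × EM => (q.1, e.symm q.2)) (t, e (c t))) := by
        simpa [e.left_inv hte] using hGt
      exact ContMDiffAt.comp (f := fun q : ℝ × EM => (q.1, e.symm q.2)) (t, e (c t)) h2
        (contMDiffAt_fst.prodMk (ContMDiffAt.comp (t, e (c t)) hsymm contMDiffAt_snd))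
    rwa [← modelWithCornersSelf_prod, chartedSpaceSelf_prod, contMDiffAt_iff_contDiffAt] at h1
  have hec : ContDiffAt ℝ ∞ (fun t => e (c t)) t :=
    contMDiffAt_iff_contDiffAt.1
      ((hesm.contMDiffAt (φ.open_source.mem_nhds hts)).comp t hct)
  -- Joint smoothness of `G` in time and position makes its spatial derivative along the curve
  -- smooth in `t`.
  have hμ : ContDiffAt ℝ ∞ (fun t => fderiv ℝ (fun y => G t (e.symm y)) (e (c t))) t :=
    ContDiffAt.fderiv (f := fun t y => G t (e.symm y)) hGe hec (m := ∞) (by simp)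
  constructor
  · rw [contDiffAt_pi]
    intro i
    refine ContDiffAt.sum fun j _ => (hμ.clm_apply contDiffAt_const).mul ?_
    exact contMDiffAt_iff_contDiffAt.1 ((a j i).contMDiff.contMDiffAt.comp t hct)
  · intro w
    have hGt' : MDifferentiableAt I 𝓘(ℝ, ℝ) (G t) (c t) :=
      (hGt.comp (f := fun y => (t, y)) (c t) (contMDiffAt_const.prodMk contMDiffAt_id)
        ).mdifferentiableAt (by simp)
    have hL : DifferentiableAt ℝ (fun y => G t (e.symm y)) (e (c t)) := by
      rw [← mdifferentiableAt_iff_differentiableAt]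
      refine MDifferentiableAt.comp (g := G t) (e (c t)) ?_ (hsymm.mdifferentiableAt (by simp))
      rwa [e.left_inv hte]
    have hGL : G t =ᶠ[𝓝 (c t)] fun y => G t (e.symm (e y)) := by
      filter_upwards [φ.open_source.mem_nhds hts] with y hy
      rw [e.left_inv (by rwa [he, φ.extend_source])]
    rw [differential_eq_fderiv_comp hφ hts hL hGL]
    obtain ⟨v, hv⟩ : ∃ v : EM, v = (mfderiv I 𝓘(ℝ, EM) (φ.extend I) (c t) : EM →L[ℝ] EM) w :=
      ⟨_, rfl⟩
    rw [← hv]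
    set D := fderiv ℝ (fun y => G t (e.symm y)) (e (c t)) with hD
    have hDv : D v = ∑ j, ℓ j v * D (b j) := by
      have h1 : D (v - N v) = 0 :=
        fderiv_comp_extend_symm_eq_zero hφ hF hts (hcS t) hGt' ht (hN v)
      rw [map_sub, sub_eq_zero] at h1
      rw [h1, hℓ, map_sum]
      simp
    have hℓv : ∀ j, ℓ j v = ∑ i, a j i (c t) * differential I (p i) (c t) w := fun j => by
      have h1 := differential_eq_fderiv_comp hφ hts (ℓ j).differentiableAt (hgt j) w
      rw [(ℓ j).fderiv, ← hv] at h1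
      have h2 : (g j : M → ℝ) = fun y => ∑ i, a j i y * p i y := by
        ext y
        rw [← ha j]
        exact map_sum (ContMDiffMap.evalRingHom y) (fun i => a j i * p i) Finset.univ
      rw [← h1, h2, differential_sum_mul_of_eq_zero (fun i => a j i) (fun i => p i)
        (fun i => (a j i).contMDiff.mdifferentiable (by simp) _)
        (fun i => (p i).contMDiff.mdifferentiable (by simp) _) (fun i => hp0 i _ (hcS t))]
    change D v = _
    rw [hDv]
    simp only [hℓv, Finset.sum_mul]
    rw [Finset.sum_comm]
    refine Finset.sum_congr rfl fun i _ => Finset.sum_congr rfl fun j _ => ?_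
    ring

/-- Local smooth selections of a family of convex sets over an open set of reals can be patched. -/
theorem exists_contDiffOn_forall_mem_convex {V : Type*} [NormedAddCommGroup V] [NormedSpace ℝ V]
    {J : Set ℝ} (hJ : IsOpen J) {C : ℝ → Set V} (hC : ∀ t, Convex ℝ (C t))
    (hloc : ∀ t₀ ∈ J, ∃ g : ℝ → V, ∀ᶠ t in 𝓝 t₀, ContDiffAt ℝ ∞ g t ∧ g t ∈ C t) :
    ∃ g : ℝ → V, ContDiffOn ℝ ∞ g J ∧ ∀ t ∈ J, g t ∈ C t := by
  classical
  -- The open set `J` is itself a σ-compact manifold, so partitions of unity exist on it; the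
  -- resulting selection is extended by `0` off `J`.
  let U : TopologicalSpace.Opens ℝ := ⟨J, hJ⟩
  have : LocallyCompactSpace U := hJ.locallyCompactSpace
  have : SigmaCompactSpace U := sigmaCompactSpace_of_locallyCompact_secondCountable
  obtain ⟨g, hg⟩ := exists_contMDiffMap_forall_mem_convex_of_local (M := U) 𝓘(ℝ, ℝ) (n := ⊤)
    (t := fun t : U => C t) (fun t => hC t) fun t₀ => by
      obtain ⟨g, hg⟩ := hloc t₀ t₀.2
      have hg' : ∀ᶠ t : U in 𝓝 t₀, ContDiffAt ℝ ∞ g t ∧ g t ∈ C t :=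
        continuous_subtype_val.continuousAt.eventually hg
      refine ⟨_, hg', fun t => g t, fun t ht => ?_, fun t ht => ht.2⟩
      exact (contMDiffAt_subtype_iff.2 ht.1.contMDiffAt).contMDiffWithinAt
  let g' : ℝ → V := fun t => if h : t ∈ J then g ⟨t, h⟩ else 0
  have hg' : ∀ t : U, g' t = g t := fun t => dif_pos t.2
  refine ⟨g', fun t ht => ?_, fun t ht => ?_⟩
  · have h1 : ContMDiffAt 𝓘(ℝ, ℝ) 𝓘(ℝ, V) ∞ (fun x : U => g' x) ⟨t, ht⟩ := by
      simpa only [hg'] using! g.contMDiff.contMDiffAt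
    exact (contMDiffAt_iff_contDiffAt.1 (contMDiffAt_subtype_iff.1 h1)).contDiffWithinAt
  · have := hg ⟨t, ht⟩
    rwa [← hg'] at this

end Multipliers

/-! ### Coordinates on the tangent and cotangent bundles -/

section Coordinates

variable {E : Type*} [NormedAddCommGroup E] [NormedSpace ℝ E]
  {Q : Type*} [TopologicalSpace Q] [ChartedSpace E Q] [IsManifold 𝓘(ℝ, E) ∞ Q]

instance : IsManifold (cotangentModel E) ∞ (CotangentBundle E Q) :=
  Bundle.TotalSpace.isManifold _ _

/-- The total space of a fibre bundle with Hausdorff base and fibre is Hausdorff. -/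
theorem t2Space_totalSpace {B F : Type*} {V : B → Type*} [TopologicalSpace B] [TopologicalSpace F]
    [TopologicalSpace (Bundle.TotalSpace F V)] [∀ b, TopologicalSpace (V b)] [FiberBundle F V]
    [T2Space B] [T2Space F] : T2Space (Bundle.TotalSpace F V) := by
  refine ⟨fun x y hxy => ?_⟩
  by_cases h : x.proj = y.proj
  · let e := trivializationAt F V x.proj
    have hx : x ∈ e.source := e.mem_source.2 (FiberBundle.mem_baseSet_trivializationAt' x.proj)
    have hy : y ∈ e.source := e.mem_source.2 (h ▸ FiberBundle.mem_baseSet_trivializationAt' x.proj)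
    obtain ⟨u, v, hu, hv, hxu, hyv, huv⟩ :=
      t2_separation (e.toOpenPartialHomeomorph.injOn.ne hx hy hxy)
    exact ⟨_, _, e.toOpenPartialHomeomorph.isOpen_inter_preimage hu,
      e.toOpenPartialHomeomorph.isOpen_inter_preimage hv, ⟨hx, hxu⟩, ⟨hy, hyv⟩,
      (huv.preimage _).mono inter_subset_right inter_subset_right⟩
  · obtain ⟨u, v, hu, hv, hxu, hyv, huv⟩ := t2_separation h
    exact ⟨_, _, hu.preimage (FiberBundle.continuous_proj F V),
      hv.preimage (FiberBundle.continuous_proj F V), hxu, hyv, huv.preimage _⟩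

variable (E) in
/-- The frame of the tangent bundle near `q` induced by the chart at `q`, as a linear map
`E → T_y Q`. -/
def frame (q y : Q) : E →L[ℝ] E := (trivializationAt E (TangentSpace 𝓘(ℝ, E)) q).symmL ℝ y

/-- The fibre coordinate on `TQ` induced by the chart at `q`. -/
def velocityCoord (q : Q) (v : TangentBundle 𝓘(ℝ, E) Q) : E :=
  (trivializationAt E (TangentSpace 𝓘(ℝ, E)) q v).2

/-- The fibre coordinate on `T*Q` induced by the chart at `q`. -/
def momentumCoord (q : Q) (ξ : CotangentBundle E Q) : E →L[ℝ] ℝ :=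
  (trivializationAt (E →L[ℝ] ℝ)
    (fun q : Q => TangentSpace 𝓘(ℝ, E) q →L[ℝ] Bundle.Trivial Q ℝ q) q ξ).2

/-- The hom bundle has a trivial target, so its trivialization only precomposes a covector with the
inverse trivialization of `TQ`. -/
theorem momentumCoord_eq (q : Q) (ξ : CotangentBundle E Q) :
    momentumCoord q ξ = (show E →L[ℝ] ℝ from ξ.snd).comp (frame E q ξ.proj) := by
  rw [momentumCoord, hom_trivializationAt_apply]
  ext v
  simp [ContinuousLinearMap.inCoordinates, frame]
  rfl

/-- The tangent vector with base point `y` and fibre coordinate `w` in the chart at `q`. -/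
def coordVector (q y : Q) (w : E) : TangentBundle 𝓘(ℝ, E) Q := ⟨y, frame E q y w⟩

theorem coordVector_velocityCoord {q : Q} {v : TangentBundle 𝓘(ℝ, E) Q}
    (h : v.proj ∈ (chartAt E q).source) : coordVector q v.proj (velocityCoord q v) = v := by
  have h1 := (trivializationAt E (TangentSpace 𝓘(ℝ, E)) q).symmL_continuousLinearMapAt
    (R := ℝ) h v.snd
  rw [Bundle.Trivialization.continuousLinearMapAt_apply,
    Bundle.Trivialization.coe_linearMapAt_of_mem _ h] at h1
  exact congrArg (Bundle.TotalSpace.mk v.proj) h1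

/-- Bridge between the bundle trivialization of `TQ` and the derivative of the inverse chart used in
`localLagrangian`. -/
theorem frame_eq_mfderiv {q y : Q} (h : y ∈ (chartAt E q).source) :
    frame E q y = (mfderiv 𝓘(ℝ, E) 𝓘(ℝ, E) (extChartAt 𝓘(ℝ, E) q).symm
      (extChartAt 𝓘(ℝ, E) q y) : E →L[ℝ] E) := by
  rw [frame, TangentBundle.symmL_trivializationAt h, ← mfderivWithin_univ]
  congr 1
  simp

/-- The tangent space at `q` is by construction `E` read in the preferred chart at `q`. -/
theorem frame_self (q : Q) : frame E q q = ContinuousLinearMap.id ℝ E := by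
  rw [frame, TangentBundle.symmL_trivializationAt (mem_chart_source E q)]
  exact mfderivWithin_range_extChartAt_symm

theorem extChartAt_cotangent (ξ η : CotangentBundle E Q) :
    extChartAt (cotangentModel E) ξ η =
      (extChartAt 𝓘(ℝ, E) ξ.proj η.proj, momentumCoord ξ.proj η) := by
  rw [FiberBundle.extChartAt]
  rfl

theorem extChartAt_tangent (v w : TangentBundle 𝓘(ℝ, E) Q) :
    extChartAt 𝓘(ℝ, E).tangent v w =
      (extChartAt 𝓘(ℝ, E) v.proj w.proj, velocityCoord v.proj w) := by
  rw [FiberBundle.extChartAt]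
  rfl

theorem localLagrangian_extChartAt (l : TangentBundle 𝓘(ℝ, E) Q → ℝ) {q y : Q}
    (h : y ∈ (chartAt E q).source) (w : E) :
    localLagrangian l q (extChartAt 𝓘(ℝ, E) q y) w = l (coordVector q y w) := by
  have h1 : (extChartAt 𝓘(ℝ, E) q).symm (extChartAt 𝓘(ℝ, E) q y) = y :=
    (extChartAt 𝓘(ℝ, E) q).left_inv (by simpa using h)
  rw [coordVector, frame_eq_mfderiv h, localLagrangian]
  congr 1
  exact Bundle.TotalSpace.ext h1 HEq.rfl

theorem contMDiffOn_coordVector (q : Q) :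
    ContMDiffOn (𝓘(ℝ, E).prod 𝓘(ℝ, E)) 𝓘(ℝ, E).tangent ∞ (fun z : Q × E => coordVector q z.1 z.2)
      ((chartAt E q).source ×ˢ univ) := by
  have h1 := (trivializationAt E (TangentSpace 𝓘(ℝ, E)) q).contMDiffOn_symm
    (IB := 𝓘(ℝ, E)) (n := ∞)
  rw [Bundle.Trivialization.target_eq] at h1
  refine h1.congr fun z hz => ?_
  rw [← Prod.mk.eta (p := z), ← Bundle.Trivialization.mk_symm _ hz.1,
    ← Bundle.Trivialization.symmL_apply (R := ℝ) _ hz.1]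
  rfl

theorem contDiffOn_localLagrangian {l : TangentBundle 𝓘(ℝ, E) Q → ℝ}
    (hl : ContMDiff 𝓘(ℝ, E).tangent 𝓘(ℝ, ℝ) ∞ l) (q : Q) :
    ContDiffOn ℝ ∞ (fun z : E × E => localLagrangian l q z.1 z.2)
      ((extChartAt 𝓘(ℝ, E) q).target ×ˢ univ) := by
  rw [← contMDiffOn_iff_contDiffOn, modelWithCornersSelf_prod, ← chartedSpaceSelf_prod]
  have h1 : ContMDiffOn (𝓘(ℝ, E).prod 𝓘(ℝ, E)) (𝓘(ℝ, E).prod 𝓘(ℝ, E)) ∞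
      (fun z : E × E => ((extChartAt 𝓘(ℝ, E) q).symm z.1, z.2))
      ((extChartAt 𝓘(ℝ, E) q).target ×ˢ univ) :=
    ((contMDiffOn_extChartAt_symm q).comp contMDiffOn_fst fun z hz => hz.1).prodMk contMDiffOn_snd
  have h2 := hl.comp_contMDiffOn ((contMDiffOn_coordVector q).comp h1 fun z hz =>
    ⟨by simpa using (extChartAt 𝓘(ℝ, E) q).map_target hz.1, mem_univ _⟩)
  refine h2.congr fun z hz => ?_
  have h3 := (extChartAt 𝓘(ℝ, E) q).map_target hz.1
  rw [extChartAt_source] at h3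
  simp only [Function.comp]
  rw [← localLagrangian_extChartAt l h3, (extChartAt 𝓘(ℝ, E) q).right_inv hz.1]

end Coordinates

section Legendre

variable {E : Type*} [NormedAddCommGroup E] [NormedSpace ℝ E]
  {Q : Type*} [TopologicalSpace Q] [ChartedSpace E Q] [IsManifold 𝓘(ℝ, E) ∞ Q]

/-! ### The symplectic form in coordinates -/

theorem proj_extChartAt_cotangent_symm {ξ : CotangentBundle E Q} {y : E × (E →L[ℝ] ℝ)}
    (hy : y ∈ (extChartAt (cotangentModel E) ξ).target) :
    ((extChartAt (cotangentModel E) ξ).symm y).proj = (extChartAt 𝓘(ℝ, E) ξ.proj).symm y.1 ∧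
      ((extChartAt (cotangentModel E) ξ).symm y).proj ∈ (chartAt E ξ.proj).source ∧
      momentumCoord ξ.proj ((extChartAt (cotangentModel E) ξ).symm y) = y.2 := by
  have h1 := (extChartAt (cotangentModel E) ξ).right_inv hy
  have h2 := (extChartAt (cotangentModel E) ξ).map_target hy
  rw [extChartAt_cotangent] at h1
  have h3 : ((extChartAt (cotangentModel E) ξ).symm y).proj ∈
      (extChartAt 𝓘(ℝ, E) ξ.proj).source := by
    rw [FiberBundle.extChartAt] at h2
    exact h2.2.1
  refine ⟨?_, by rwa [extChartAt_source] at h3, congrArg Prod.snd h1⟩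
  rw [← congrArg Prod.fst h1, (extChartAt 𝓘(ℝ, E) ξ.proj).left_inv h3]

/-- The local representative of `ϑ₀` is `p dq`: in coordinates the bundle projection is `Prod.fst`
followed by the inverse chart of `Q`, and a covector composed with the frame is its momentum. -/
theorem canonicalOneForm_comp_mfderiv {ξ : CotangentBundle E Q} {y : E × (E →L[ℝ] ℝ)}
    (hy : y ∈ (extChartAt (cotangentModel E) ξ).target) :
    ((canonicalOneForm ((extChartAt (cotangentModel E) ξ).symm y)).comp
      (mfderiv 𝓘(ℝ, E × (E →L[ℝ] ℝ)) (cotangentModel E) (extChartAt (cotangentModel E) ξ).symm y) :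
        E × (E →L[ℝ] ℝ) →L[ℝ] ℝ) = y.2.comp (ContinuousLinearMap.fst ℝ E (E →L[ℝ] ℝ)) := by
  obtain ⟨h1, h2, h3⟩ := proj_extChartAt_cotangent_symm hy
  set e := extChartAt (cotangentModel E) ξ with he
  have htgt : e.target ∈ 𝓝 y := (isOpen_extChartAt_target ξ).mem_nhds hy
  have hsymm : MDifferentiableAt 𝓘(ℝ, E × (E →L[ℝ] ℝ)) (cotangentModel E) e.symm y :=
    ((contMDiffOn_extChartAt_symm (n := ∞) ξ).contMDiffAt htgt).mdifferentiableAt (by simp)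
  have hproj : MDifferentiableAt (cotangentModel E) 𝓘(ℝ, E)
      (fun η : CotangentBundle E Q => η.proj) (e.symm y) :=
    (Bundle.contMDiff_proj (n := ∞) _ _).mdifferentiableAt (by simp)
  have hy1 : y.1 ∈ (extChartAt 𝓘(ℝ, E) ξ.proj).target := by
    rw [FiberBundle.extChartAt_target] at hy
    exact hy.1.1
  have hφ : MDifferentiableAt 𝓘(ℝ, E) 𝓘(ℝ, E) (extChartAt 𝓘(ℝ, E) ξ.proj).symm y.1 :=
    ((contMDiffOn_extChartAt_symm (n := ∞) ξ.proj).contMDiffAt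
      ((isOpen_extChartAt_target ξ.proj).mem_nhds hy1)).mdifferentiableAt (by simp)
  have hfst : HasMFDerivAt 𝓘(ℝ, E × (E →L[ℝ] ℝ)) 𝓘(ℝ, E) (Prod.fst : E × (E →L[ℝ] ℝ) → E) y
      (ContinuousLinearMap.fst ℝ E (E →L[ℝ] ℝ)) := hasFDerivAt_fst.hasMFDerivAt
  have hA := hproj.hasMFDerivAt.comp y hsymm.hasMFDerivAt
  have hB := (hφ.hasMFDerivAt.comp y hfst).congr_of_eventuallyEq
    (f₁ := (fun η : CotangentBundle E Q => η.proj) ∘ e.symm) (by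
      filter_upwards [htgt] with z hz
      exact (proj_extChartAt_cotangent_symm hz).1)
  have hC := hasMFDerivAt_unique hA hB
  have hF : (mfderiv 𝓘(ℝ, E) 𝓘(ℝ, E) (extChartAt 𝓘(ℝ, E) ξ.proj).symm y.1 : E →L[ℝ] E) =
      frame E ξ.proj (e.symm y).proj := by
    rw [frame_eq_mfderiv h2, h1, (extChartAt 𝓘(ℝ, E) ξ.proj).right_inv hy1]
  rw [← h3, momentumCoord_eq, ContinuousLinearMap.comp_assoc, ← hF]
  exact congrArg (fun L : E × (E →L[ℝ] ℝ) →L[ℝ] E =>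
    (show E →L[ℝ] ℝ from (e.symm y).snd).comp L) hC

/-- The coefficients of `p dq` depend linearly on the point, so their derivative is the constant map
`B`. The preferred chart at `ξ` has identity derivative there, so no change of coordinates appears.
-/
theorem symplecticForm_eq (ξ : CotangentBundle E Q) (u w : E × (E →L[ℝ] ℝ)) :
    symplecticForm ξ u w = u.2 w.1 - w.2 u.1 := by
  let B : E × (E →L[ℝ] ℝ) →L[ℝ] E × (E →L[ℝ] ℝ) →L[ℝ] ℝ :=
    ((ContinuousLinearMap.compL ℝ (E × (E →L[ℝ] ℝ)) E ℝ).flip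
      (ContinuousLinearMap.fst ℝ E (E →L[ℝ] ℝ))).comp (ContinuousLinearMap.snd ℝ E (E →L[ℝ] ℝ))
  let θ : E × (E →L[ℝ] ℝ) → E × (E →L[ℝ] ℝ) →L[ℝ] ℝ := fun y =>
    (canonicalOneForm ((extChartAt (cotangentModel E) ξ).symm y)).comp
      (mfderiv 𝓘(ℝ, E × (E →L[ℝ] ℝ)) (cotangentModel E) (extChartAt (cotangentModel E) ξ).symm y)
  have h1 : θ =ᶠ[𝓝 (extChartAt (cotangentModel E) ξ ξ)] B := by
    filter_upwards [extChartAt_target_mem_nhds ξ] with y hy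
    exact canonicalOneForm_comp_mfderiv hy
  have h2 : fderiv ℝ θ (extChartAt (cotangentModel E) ξ ξ) = B :=
    ((ContinuousLinearMap.hasFDerivAt (𝕜 := ℝ) (E := E × (E →L[ℝ] ℝ))
      (F := E × (E →L[ℝ] ℝ) →L[ℝ] ℝ) B).congr_of_eventuallyEq h1).fderiv
  let D : E × (E →L[ℝ] ℝ) →L[ℝ] E × (E →L[ℝ] ℝ) :=
    mfderiv (cotangentModel E) 𝓘(ℝ, E × (E →L[ℝ] ℝ)) (extChartAt (cotangentModel E) ξ) ξ
  have hD : D = ContinuousLinearMap.id ℝ _ :=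
    mfderiv_extChartAt_self (I := cotangentModel E) (x := ξ)
  have h3 : ∀ v, D v = v := fun v => by rw [hD]; rfl
  have h4 : symplecticForm ξ u w = B u w - B w u := by
    have h5 : symplecticForm ξ u w =
      fderiv ℝ θ (extChartAt (cotangentModel E) ξ ξ) (D u) (D w) -
        fderiv ℝ θ (extChartAt (cotangentModel E) ξ ξ) (D w) (D u) := rfl
    rw [h5, h2, h3, h3]
  exact h4

/-- Every smooth function on `T*Q` has a Hamiltonian vector at each point. -/
theorem exists_symplecticForm_eq [FiniteDimensional ℝ E] (ξ : CotangentBundle E Q)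
    (D : E × (E →L[ℝ] ℝ) →L[ℝ] ℝ) :
    ∃ u : E × (E →L[ℝ] ℝ), ∀ w : E × (E →L[ℝ] ℝ), symplecticForm ξ u w = -D w := by
  -- The position component of the Hamiltonian vector must represent `β ↦ D (0, β)`, an element of
  -- the bidual; finite dimension brings it back to `E`.
  let A : Module.Dual ℝ (Module.Dual ℝ E) :=
    (D.toLinearMap ∘ₗ LinearMap.inr ℝ E (E →L[ℝ] ℝ)) ∘ₗ
      (LinearMap.toContinuousLinearMap (𝕜 := ℝ) (E := E) (F' := ℝ)).toLinearMap
  refine ⟨((Module.evalEquiv ℝ E).symm A, -(D.comp (ContinuousLinearMap.inl ℝ E (E →L[ℝ] ℝ)))),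
    fun w => ?_⟩
  have h1 : w.2 ((Module.evalEquiv ℝ E).symm A) = D (0, w.2) := by
    have h2 := Module.apply_evalEquiv_symm_apply (R := ℝ) (M := E) w.2.toLinearMap A
    exact h2
  have h3 : D w = D (w.1, 0) + D (0, w.2) := by rw [← map_add]; simp
  rw [symplecticForm_eq, h1, h3]
  simp
  ring

/-! ### The Legendre transformation in coordinates -/

variable {l : TangentBundle 𝓘(ℝ, E) Q → ℝ} (hl : ContMDiff 𝓘(ℝ, E).tangent 𝓘(ℝ, ℝ) ∞ l)
include hl

theorem contDiffAt_localLagrangian {q : Q} {x : E} (hx : x ∈ (extChartAt 𝓘(ℝ, E) q).target)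
    (w : E) : ContDiffAt ℝ ∞ (fun z : E × E => localLagrangian l q z.1 z.2) (x, w) :=
  (contDiffOn_localLagrangian hl q).contDiffAt
    (((isOpen_extChartAt_target q).prod isOpen_univ).mem_nhds ⟨hx, mem_univ _⟩)

theorem contDiff_fibre (y : Q) :
    ContDiff ℝ ∞ (fun w : E => l ⟨y, w⟩) := by
  have h1 : (fun w : E => l ⟨y, w⟩) = fun w => localLagrangian l y (extChartAt 𝓘(ℝ, E) y y) w := by
    ext w
    rw [localLagrangian_extChartAt l (mem_chart_source E y), coordVector, frame_self]
    rfl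
  rw [h1, contDiff_iff_contDiffAt]
  intro w
  exact (contDiffAt_localLagrangian hl (mem_extChartAt_target y) w).comp w
    (contDiffAt_const.prodMk contDiffAt_id)

/-- This is `p = ∂L/∂v`: the local Lagrangian on a fibre is `l` composed with the frame, and the
chain rule composes its derivative with the frame just as `momentumCoord` does. -/
theorem momentumCoord_legendre {q : Q} {v : TangentBundle 𝓘(ℝ, E) Q}
    (h : v.proj ∈ (chartAt E q).source) :
    momentumCoord q (legendre l v) =
      fderiv ℝ (localLagrangian l q (extChartAt 𝓘(ℝ, E) q v.proj)) (velocityCoord q v) := by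
  have h1 : localLagrangian l q (extChartAt 𝓘(ℝ, E) q v.proj) =
      (fun w : E => l ⟨v.proj, w⟩) ∘ frame E q v.proj := by
    ext w
    exact localLagrangian_extChartAt l h w
  have h2 : frame E q v.proj (velocityCoord q v) = v.snd :=
    eq_of_heq (Bundle.TotalSpace.ext_iff.1 (coordVector_velocityCoord h)).2
  rw [momentumCoord_eq, h1, fderiv_comp _ ((contDiff_fibre hl _).differentiable (by simp) _)
    (frame E q v.proj).differentiableAt, (frame E q v.proj).fderiv, h2]
  rfl

/-- The fibre derivative of the local Lagrangian is smooth. -/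
theorem contDiffAt_fderiv_localLagrangian {q : Q} {x : E}
    (hx : x ∈ (extChartAt 𝓘(ℝ, E) q).target) (w : E) :
    ContDiffAt ℝ ∞ (fun z : E × E => fderiv ℝ (localLagrangian l q z.1) z.2) (x, w) := by
  refine ContDiffAt.fderiv (f := fun (z : E × E) v => localLagrangian l q z.1 v)
    (g := fun z : E × E => z.2) (n := ∞) (m := ∞) ?_ contDiffAt_snd (by simp)
  exact ContDiffAt.comp (g := fun z : E × E => localLagrangian l q z.1 z.2)
    (f := fun a : (E × E) × E => (a.1.1, a.2)) ((x, w), w) (contDiffAt_localLagrangian hl hx w)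
    ((contDiffAt_fst.comp _ contDiffAt_fst).prodMk contDiffAt_snd)

theorem contMDiff_legendre : ContMDiff 𝓘(ℝ, E).tangent (cotangentModel E) ∞ (legendre l) := by
  intro v
  rw [Bundle.contMDiffAt_totalSpace]
  refine ⟨Bundle.contMDiff_proj _ v, ?_⟩
  have h1 : ContMDiffAt 𝓘(ℝ, E).tangent 𝓘(ℝ, E × E) ∞
      (fun w : TangentBundle 𝓘(ℝ, E) Q =>
        (extChartAt 𝓘(ℝ, E) v.proj w.proj, velocityCoord v.proj w)) v := by
    simpa only [← extChartAt_tangent] using! contMDiffAt_extChartAt (I := 𝓘(ℝ, E).tangent) (x := v)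
  have h2 := (contDiffAt_fderiv_localLagrangian hl (mem_extChartAt_target v.proj)
    (velocityCoord v.proj v)).contMDiffAt.comp v h1
  refine h2.congr_of_eventuallyEq ?_
  filter_upwards [(FiberBundle.continuous_proj E (TangentSpace 𝓘(ℝ, E))).continuousAt.eventually_mem
    ((chartAt E v.proj).open_source.mem_nhds (mem_chart_source E v.proj))] with w hw
  exact momentumCoord_legendre hl hw

/-! ### The first jet of a curve in coordinates. -/

omit hl in
theorem velocityCoord_firstJet {γ : ℝ → Q} {t : ℝ} (hγ : MDifferentiableAt 𝓘(ℝ, ℝ) 𝓘(ℝ, E) γ t)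
    {q : Q} (h : γ t ∈ (chartAt E q).source) :
    velocityCoord q (firstJet γ t) = deriv (fun s => extChartAt 𝓘(ℝ, E) q (γ s)) t := by
  have h1 : velocityCoord q (firstJet γ t) =
      (trivializationAt E (TangentSpace 𝓘(ℝ, E)) q).continuousLinearMapAt ℝ (γ t)
        (mfderiv 𝓘(ℝ, ℝ) 𝓘(ℝ, E) γ t (1 : ℝ)) := by
    rw [Bundle.Trivialization.continuousLinearMapAt_apply,
      Bundle.Trivialization.coe_linearMapAt_of_mem _ h]
    rfl
  rw [h1, TangentBundle.continuousLinearMapAt_trivializationAt h]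
  let A : E →L[ℝ] E := mfderiv 𝓘(ℝ, E) 𝓘(ℝ, E) (extChartAt 𝓘(ℝ, E) q) (γ t)
  let B : ℝ →L[ℝ] E := mfderiv 𝓘(ℝ, ℝ) 𝓘(ℝ, E) γ t
  have h2 : HasFDerivAt (fun s => extChartAt 𝓘(ℝ, E) q (γ s)) (A.comp B) t :=
    hasMFDerivAt_iff_hasFDerivAt.1
      (HasMFDerivAt.comp t (mdifferentiableAt_extChartAt h).hasMFDerivAt hγ.hasMFDerivAt)
  exact h2.hasDerivAt.deriv.symm

omit hl in
theorem contMDiffAt_firstJet {γ : ℝ → Q} {J : Set ℝ} (hJ : IsOpen J)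
    (hγ : ContMDiffOn 𝓘(ℝ, ℝ) 𝓘(ℝ, E) ∞ γ J) {t : ℝ} (ht : t ∈ J) :
    ContMDiffAt 𝓘(ℝ, ℝ) 𝓘(ℝ, E).tangent ∞
      (firstJet γ : ℝ → TangentBundle 𝓘(ℝ, E) Q) t := by
  have hγt := hγ.contMDiffAt (hJ.mem_nhds ht)
  rw [Bundle.contMDiffAt_totalSpace]
  refine ⟨hγt, ?_⟩
  have h1 : ContDiffAt ℝ ∞ (fun s => extChartAt 𝓘(ℝ, E) (γ t) (γ s)) t :=
    contMDiffAt_iff_contDiffAt.1 (contMDiffAt_extChartAt.comp t hγt)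
  have h2 : ContDiffAt ℝ ∞ (deriv fun s => extChartAt 𝓘(ℝ, E) (γ t) (γ s)) t :=
    (h1.fderiv_right (m := ∞) (by simp)).clm_apply contDiffAt_const
  refine h2.contMDiffAt.congr_of_eventuallyEq ?_
  filter_upwards [hJ.mem_nhds ht, hγt.continuousAt.eventually_mem
    ((chartAt E (γ t)).open_source.mem_nhds (mem_chart_source E (γ t)))] with s hs hsq
  exact velocityCoord_firstJet ((hγ.contMDiffAt (hJ.mem_nhds hs)).mdifferentiableAt (by simp)) hsq

end Legendre

/-! ### First-variation computations in vector spaces. -/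

section Calculus

variable {E : Type*} [NormedAddCommGroup E] [NormedSpace ℝ E]

/-- The differential of `(x, p) ↦ p (V x) - L(x, V x)` at a point with `p = ∂L/∂v`. -/
theorem hasFDerivAt_apply_sub {L : E × E → ℝ} {V : E → E} {x : E} {p : E →L[ℝ] ℝ}
    (hV : DifferentiableAt ℝ V x) (hL : DifferentiableAt ℝ L (x, V x))
    (hp : ∀ a, fderiv ℝ L (x, V x) (0, a) = p a) :
    ∃ D : E × (E →L[ℝ] ℝ) →L[ℝ] ℝ,
      HasFDerivAt (fun z : E × (E →L[ℝ] ℝ) => z.2 (V z.1) - L (z.1, V z.1)) D (x, p) ∧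
      ∀ b β, D (b, β) = β (V x) - fderiv ℝ L (x, V x) (b, 0) := by
  have hV1 : HasFDerivAt (fun z : E × (E →L[ℝ] ℝ) => V z.1)
      ((fderiv ℝ V x).comp (ContinuousLinearMap.fst ℝ E (E →L[ℝ] ℝ))) (x, p) :=
    HasFDerivAt.comp (g := V) (f := Prod.fst) (x, p) hV.hasFDerivAt hasFDerivAt_fst
  have hL1 := HasFDerivAt.comp (g := L) (f := fun z : E × (E →L[ℝ] ℝ) => (z.1, V z.1)) (x, p)
    hL.hasFDerivAt (hasFDerivAt_fst.prodMk hV1)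
  refine ⟨_, (hasFDerivAt_snd.clm_apply hV1).sub hL1, fun b β => ?_⟩
  -- The derivative of `V` enters through `p` once from the pairing and once from `L`, with opposite
  -- signs, so it drops out.
  have h1 : fderiv ℝ L (x, V x) (b, fderiv ℝ V x b) =
      fderiv ℝ L (x, V x) (b, 0) + p (fderiv ℝ V x b) := by
    rw [← hp, ← map_add]
    simp
  simp [h1]
  ring

/-- The function `(x, v) ↦ C(x, v) (V x - v) - L(x, V x) + L(x, v)` is critical at `v = V x` if
`C = ∂L/∂v` there. -/
theorem hasFDerivAt_defect {L : E × E → ℝ} {V : E → E} {x : E} {C : E × E → E →L[ℝ] ℝ}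
    (hV : DifferentiableAt ℝ V x) (hL : DifferentiableAt ℝ L (x, V x))
    (hC : DifferentiableAt ℝ C (x, V x))
    (hp : ∀ a, fderiv ℝ L (x, V x) (0, a) = C (x, V x) a) :
    HasFDerivAt (fun z : E × E => C z (V z.1 - z.2) - L (z.1, V z.1) + L z)
      (0 : E × E →L[ℝ] ℝ) (x, V x) := by
  have hV1 : HasFDerivAt (fun z : E × E => V z.1)
      ((fderiv ℝ V x).comp (ContinuousLinearMap.fst ℝ E E)) (x, V x) :=
    HasFDerivAt.comp (g := V) (f := Prod.fst) (x, V x) hV.hasFDerivAt hasFDerivAt_fst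
  have hL1 := HasFDerivAt.comp (g := L) (f := fun z : E × E => (z.1, V z.1)) (x, V x)
    hL.hasFDerivAt (hasFDerivAt_fst.prodMk hV1)
  have h := ((hC.hasFDerivAt.clm_apply (hV1.sub hasFDerivAt_snd)).sub hL1).add hL.hasFDerivAt
  refine h.congr_fderiv ?_
  refine ContinuousLinearMap.ext fun ⟨b, a⟩ => ?_
  -- The derivative of `C` is multiplied by `V x - v = 0`; what remains of the pairing cancels
  -- against the difference of the two `L` terms.
  have h1 : fderiv ℝ L (x, V x) (b, fderiv ℝ V x b) =
      fderiv ℝ L (x, V x) (b, a) + C (x, V x) (fderiv ℝ V x b - a) := by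
    rw [← hp, ← map_add]
    simp
  simp [h1]

end Calculus

/-! ### Differentials in the preferred chart. -/

section SelfChart

variable {EM : Type*} [NormedAddCommGroup EM] [NormedSpace ℝ EM]
  {HM : Type*} [TopologicalSpace HM] {I : ModelWithCorners ℝ EM HM} [I.Boundaryless]
  {M : Type*} [TopologicalSpace M] [ChartedSpace HM M] [IsManifold I ∞ M]

/-- The differential at `x`, computed in the preferred chart at `x`. -/
theorem differential_eq_of_hasFDerivAt {x : M} {G : M → ℝ} {L : EM → ℝ} {D : EM →L[ℝ] ℝ}
    (hL : HasFDerivAt L D (extChartAt I x x))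
    (hGL : G =ᶠ[𝓝 x] fun y => L (extChartAt I x y)) : differential I G x = D := by
  ext w
  rw [differential_eq_fderiv_comp (IsManifold.chart_mem_maximalAtlas (n := ∞) x)
    (mem_chart_source _ x) (L := L) hL.differentiableAt hGL]
  let A : EM →L[ℝ] EM := mfderiv I 𝓘(ℝ, EM) (extChartAt I x) x
  have hA : A = ContinuousLinearMap.id ℝ EM := mfderiv_extChartAt_self (I := I) (x := x)
  have h1 : fderiv ℝ L (extChartAt I x x) (A w) = D w := by rw [hA, hL.fderiv]; rfl
  exact h1

end SelfChart

/-! ### The function `ξ ↦ ⟨ξ, V⟩ - l(V)` on the cotangent bundle -/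

section Pairing

variable {E : Type*} [NormedAddCommGroup E] [NormedSpace ℝ E]
  {Q : Type*} [TopologicalSpace Q] [ChartedSpace E Q] [IsManifold 𝓘(ℝ, E) ∞ Q]

/-! ### The function `ξ ↦ ⟨ξ, V⟩ - l(V)` for a vector field `V` constant in a chart -/

theorem momentumCoord_velocityCoord {q : Q} (ξ : CotangentBundle E Q)
    (h : ξ.proj ∈ (chartAt E q).source) (w : E) :
    momentumCoord q ξ (velocityCoord q ⟨ξ.proj, w⟩) = (show E →L[ℝ] ℝ from ξ.snd) w := by
  have h1 : frame E q ξ.proj (velocityCoord q ⟨ξ.proj, w⟩) = w :=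
    eq_of_heq (Bundle.TotalSpace.ext_iff.1 (coordVector_velocityCoord (v := ⟨ξ.proj, w⟩) h)).2
  rw [momentumCoord_eq, ContinuousLinearMap.comp_apply, h1]

/-- The function `ξ ↦ ⟨ξ, V⟩ - l(V)` on `T*Q`, where `V` is the vector field which is constant
equal to `w` in the chart at `q₀`. -/
def pairing (l : TangentBundle 𝓘(ℝ, E) Q → ℝ) (q₀ : Q) (w : E) (ξ : CotangentBundle E Q) : ℝ :=
  momentumCoord q₀ ξ w - l (coordVector q₀ ξ.proj w)

/-- The vector field constant equal to `w` in the chart at `q₀`, read in the chart at `q`. -/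
def fieldCoord (q₀ q : Q) (w x : E) : E :=
  velocityCoord q (coordVector q₀ ((extChartAt 𝓘(ℝ, E) q).symm x) w)

/-- Both `⟨ξ, V⟩` and `l(V)` are independent of the chart. The change is needed because
`symplecticForm_eq` uses the chart at the moving base point, where `V` need no longer be constant.
-/
theorem pairing_eq (l : TangentBundle 𝓘(ℝ, E) Q → ℝ) (q₀ : Q) {q : Q} (w : E)
    {ξ : CotangentBundle E Q} (h : ξ.proj ∈ (chartAt E q).source) :
    pairing l q₀ w ξ =
      momentumCoord q ξ (fieldCoord q₀ q w (extChartAt 𝓘(ℝ, E) q ξ.proj)) -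
        localLagrangian l q (extChartAt 𝓘(ℝ, E) q ξ.proj)
          (fieldCoord q₀ q w (extChartAt 𝓘(ℝ, E) q ξ.proj)) := by
  have h1 : (extChartAt 𝓘(ℝ, E) q).symm (extChartAt 𝓘(ℝ, E) q ξ.proj) = ξ.proj :=
    (extChartAt 𝓘(ℝ, E) q).left_inv (by rwa [extChartAt_source])
  have h2 : coordVector q ξ.proj (velocityCoord q (coordVector q₀ ξ.proj w)) =
      coordVector q₀ ξ.proj w :=
    coordVector_velocityCoord (v := coordVector q₀ ξ.proj w) h
  rw [localLagrangian_extChartAt l h, fieldCoord, h1, h2, pairing, coordVector,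
    momentumCoord_velocityCoord ξ h, momentumCoord_eq]
  rfl

theorem fieldCoord_self {q₀ : Q} {v : TangentBundle 𝓘(ℝ, E) Q}
    (h : v.proj ∈ (chartAt E q₀).source) :
    fieldCoord q₀ v.proj (velocityCoord q₀ v) (extChartAt 𝓘(ℝ, E) v.proj v.proj) =
      velocityCoord v.proj v := by
  rw [fieldCoord, extChartAt_to_inv, coordVector_velocityCoord h]

theorem contMDiffAt_velocityCoord (v : TangentBundle 𝓘(ℝ, E) Q) :
    ContMDiffAt 𝓘(ℝ, E).tangent 𝓘(ℝ, E) ∞ (velocityCoord v.proj) v :=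
  (Bundle.contMDiffAt_totalSpace.1 contMDiffAt_id).2

theorem differentiableAt_fieldCoord {q₀ : Q} {v : TangentBundle 𝓘(ℝ, E) Q}
    (h : v.proj ∈ (chartAt E q₀).source) :
    DifferentiableAt ℝ (fieldCoord q₀ v.proj (velocityCoord q₀ v))
      (extChartAt 𝓘(ℝ, E) v.proj v.proj) := by
  have h1 : ContMDiffAt 𝓘(ℝ, E) 𝓘(ℝ, E) ∞ (extChartAt 𝓘(ℝ, E) v.proj).symm
      (extChartAt 𝓘(ℝ, E) v.proj v.proj) :=
    (contMDiffOn_extChartAt_symm v.proj).contMDiffAt (extChartAt_target_mem_nhds v.proj)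
  have h2 : ContMDiffAt (𝓘(ℝ, E).prod 𝓘(ℝ, E)) 𝓘(ℝ, E).tangent ∞
      (fun z : Q × E => coordVector q₀ z.1 z.2)
      ((extChartAt 𝓘(ℝ, E) v.proj).symm (extChartAt 𝓘(ℝ, E) v.proj v.proj),
        velocityCoord q₀ v) := by
    rw [extChartAt_to_inv]
    exact (contMDiffOn_coordVector q₀).contMDiffAt
      (((chartAt E q₀).open_source.prod isOpen_univ).mem_nhds ⟨h, mem_univ _⟩)
  have h3 := ContMDiffAt.comp (f := fun x => ((extChartAt 𝓘(ℝ, E) v.proj).symm x,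
    velocityCoord q₀ v)) _ h2 (h1.prodMk contMDiffAt_const)
  have h4 : ContMDiffAt 𝓘(ℝ, E).tangent 𝓘(ℝ, E) ∞ (velocityCoord v.proj)
      (((fun z : Q × E => coordVector q₀ z.1 z.2) ∘ fun x =>
        ((extChartAt 𝓘(ℝ, E) v.proj).symm x, velocityCoord q₀ v))
        (extChartAt 𝓘(ℝ, E) v.proj v.proj)) := by
    simp only [Function.comp, extChartAt_to_inv, coordVector_velocityCoord h]
    exact contMDiffAt_velocityCoord v
  exact (contMDiffAt_iff_contDiffAt.1 (h4.comp _ h3)).differentiableAt (by simp)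

theorem contMDiffAt_momentumCoord {q : Q} {ξ : CotangentBundle E Q}
    (h : ξ.proj ∈ (chartAt E q).source) :
    ContMDiffAt (cotangentModel E) 𝓘(ℝ, E →L[ℝ] ℝ) ∞ (momentumCoord q) ξ := by
  let e := trivializationAt (E →L[ℝ] ℝ)
    (fun q : Q => TangentSpace 𝓘(ℝ, E) q →L[ℝ] Bundle.Trivial Q ℝ q) q
  have h1 : ξ ∈ e.source := e.mem_source.2 ⟨h, mem_univ _⟩
  exact ((e.contMDiffOn (IB := 𝓘(ℝ, E)) (n := ∞)).contMDiffAt (e.open_source.mem_nhds h1)).snd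

variable {l : TangentBundle 𝓘(ℝ, E) Q → ℝ} (hl : ContMDiff 𝓘(ℝ, E).tangent 𝓘(ℝ, ℝ) ∞ l)
include hl

/-- Keeping the chart at `q₀` fixed while `t` varies is what yields smoothness jointly in time and
position. -/
theorem contMDiffAt_pairing {q₀ : Q} {w : ℝ → E} {t : ℝ} (hw : ContDiffAt ℝ ∞ w t)
    {ξ : CotangentBundle E Q} (h : ξ.proj ∈ (chartAt E q₀).source) :
    ContMDiffAt (𝓘(ℝ, ℝ).prod (cotangentModel E)) 𝓘(ℝ, ℝ) ∞
      (fun z : ℝ × CotangentBundle E Q => pairing l q₀ (w z.1) z.2) (t, ξ) := by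
  have h1 : ContMDiffAt (𝓘(ℝ, ℝ).prod (cotangentModel E)) 𝓘(ℝ, E) ∞
      (fun z : ℝ × CotangentBundle E Q => w z.1) (t, ξ) :=
    hw.contMDiffAt.comp (t, ξ) contMDiffAt_fst
  have h2 : ContMDiffAt (𝓘(ℝ, ℝ).prod (cotangentModel E)) 𝓘(ℝ, E →L[ℝ] ℝ) ∞
      (fun z : ℝ × CotangentBundle E Q => momentumCoord q₀ z.2) (t, ξ) :=
    ContMDiffAt.comp (g := momentumCoord q₀) (f := Prod.snd) (t, ξ)
      (contMDiffAt_momentumCoord h) contMDiffAt_snd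
  have h3 : ContMDiffAt (𝓘(ℝ, ℝ).prod (cotangentModel E)) 𝓘(ℝ, E) ∞
      (fun z : ℝ × CotangentBundle E Q => z.2.proj) (t, ξ) :=
    (Bundle.contMDiff_proj _ ξ).comp (t, ξ) contMDiffAt_snd
  have h4 : ContMDiffAt (𝓘(ℝ, E).prod 𝓘(ℝ, E)) 𝓘(ℝ, E).tangent ∞
      (fun z : Q × E => coordVector q₀ z.1 z.2) (ξ.proj, w t) :=
    (contMDiffOn_coordVector q₀).contMDiffAt
      (((chartAt E q₀).open_source.prod isOpen_univ).mem_nhds ⟨h, mem_univ _⟩)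
  have h5 := ContMDiffAt.comp (f := fun z : ℝ × CotangentBundle E Q => (z.2.proj, w z.1))
    (t, ξ) h4 (h3.prodMk h1)
  exact (h2.clm_apply h1).sub (hl.contMDiffAt.comp (t, ξ) h5)

/-- The differential of the local Lagrangian, split into its two partial derivatives. -/
theorem fderiv_localLagrangian_apply {q : Q} {x : E} (hx : x ∈ (extChartAt 𝓘(ℝ, E) q).target)
    (w b a : E) :
    fderiv ℝ (fun z : E × E => localLagrangian l q z.1 z.2) (x, w) (b, a) =
      fderiv ℝ (fun y => localLagrangian l q y w) x b +
        fderiv ℝ (localLagrangian l q x) w a := by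
  have h1 := ((contDiffAt_localLagrangian hl hx w).differentiableAt (by simp)).hasFDerivAt
  have h2 : HasFDerivAt (fun y => localLagrangian l q y w) _ x :=
    HasFDerivAt.comp (g := fun z : E × E => localLagrangian l q z.1 z.2) (f := fun y => (y, w)) x
      h1 (hasFDerivAt_prodMk_left x w)
  have h3 : HasFDerivAt (localLagrangian l q x) _ w :=
    HasFDerivAt.comp (g := fun z : E × E => localLagrangian l q z.1 z.2) (f := fun y => (x, y)) w
      h1 (hasFDerivAt_prodMk_right x w)
  rw [h2.fderiv, h3.fderiv, ContinuousLinearMap.comp_apply, ContinuousLinearMap.comp_apply,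
    ← map_add]
  simp

theorem fderiv_localLagrangian_snd {v : TangentBundle 𝓘(ℝ, E) Q} (a : E) :
    fderiv ℝ (fun z : E × E => localLagrangian l v.proj z.1 z.2)
      (extChartAt 𝓘(ℝ, E) v.proj v.proj, velocityCoord v.proj v) (0, a) =
        momentumCoord v.proj (legendre l v) a := by
  rw [fderiv_localLagrangian_apply hl (mem_extChartAt_target v.proj),
    momentumCoord_legendre hl (mem_chart_source E v.proj), map_zero, zero_add]

/-- Since `p = ∂L/∂v` at `𝓛(v)`, the derivative of the field extending `v` cancels
(`hasFDerivAt_apply_sub`): the answer depends on `v` alone, not on the chart at `q₀`. -/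
theorem differential_pairing {q₀ : Q} {v : TangentBundle 𝓘(ℝ, E) Q}
    (h : v.proj ∈ (chartAt E q₀).source) (b : E) (β : E →L[ℝ] ℝ) :
    differential (cotangentModel E) (pairing l q₀ (velocityCoord q₀ v)) (legendre l v) (b, β) =
      β (velocityCoord v.proj v) -
        fderiv ℝ (fun y => localLagrangian l v.proj y (velocityCoord v.proj v))
          (extChartAt 𝓘(ℝ, E) v.proj v.proj) b := by
  have hV₀ := fieldCoord_self h
  obtain ⟨D, hD, hDb⟩ := hasFDerivAt_apply_sub
    (L := fun z : E × E => localLagrangian l v.proj z.1 z.2)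
    (p := momentumCoord v.proj (legendre l v)) (differentiableAt_fieldCoord h)
    (by
      rw [hV₀]
      exact (contDiffAt_localLagrangian hl (mem_extChartAt_target v.proj) _).differentiableAt
        (by simp))
    (by rw [hV₀]; exact fderiv_localLagrangian_snd hl)
  have hcont := FiberBundle.continuous_proj (E →L[ℝ] ℝ)
    (fun q : Q => TangentSpace 𝓘(ℝ, E) q →L[ℝ] Bundle.Trivial Q ℝ q)
  have hG : pairing l q₀ (velocityCoord q₀ v) =ᶠ[𝓝 (legendre l v)] fun η =>
      (fun z : E × (E →L[ℝ] ℝ) => z.2 (fieldCoord q₀ v.proj (velocityCoord q₀ v) z.1) -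
        localLagrangian l v.proj z.1 (fieldCoord q₀ v.proj (velocityCoord q₀ v) z.1))
        (extChartAt (cotangentModel E) (legendre l v) η) := by
    filter_upwards [hcont.continuousAt.eventually_mem
      ((chartAt E v.proj).open_source.mem_nhds (mem_chart_source E v.proj))] with η hη
    rw [pairing_eq l q₀ _ hη, extChartAt_cotangent]
    rfl
  have h1 := differential_eq_of_hasFDerivAt (I := cotangentModel E)
    (x := legendre l v) (D := D) (by rw [extChartAt_cotangent]; exact hD) hG
  have h2 := fderiv_localLagrangian_apply hl (mem_extChartAt_target v.proj)
    (velocityCoord v.proj v) b 0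
  rw [map_zero, add_zero] at h2
  rw [h1, hDb, hV₀, h2]

omit hl in
theorem energy_eq {q : Q} {v : TangentBundle 𝓘(ℝ, E) Q} (h : v.proj ∈ (chartAt E q).source) :
    energy l v = momentumCoord q (legendre l v) (velocityCoord q v) -
      localLagrangian l q (extChartAt 𝓘(ℝ, E) q v.proj) (velocityCoord q v) := by
  rw [localLagrangian_extChartAt l h, coordVector_velocityCoord h]
  exact congrArg (· - l v) (momentumCoord_velocityCoord (legendre l v) h v.snd).symm

/-- The function `ξ ↦ ⟨ξ, V⟩ - l(V) - h(ξ)` has vanishing differential on vectors tangent to the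
primary constraint set. -/
theorem differential_pairing_sub_eq_zero (hsubm : IsLegendreSubmersion l) {h : SmoothFunctions E Q}
    (hh : ∀ v, h (legendre l v) = energy l v) {q₀ : Q} {v : TangentBundle 𝓘(ℝ, E) Q}
    (hv : v.proj ∈ (chartAt E q₀).source) {u : E × (E →L[ℝ] ℝ)}
    (hu : IsTangentTo (cotangentModel E) (primaryConstraintSet l) (legendre l v) u) :
    differential (cotangentModel E) (fun ξ => pairing l q₀ (velocityCoord q₀ v) ξ - h ξ)
      (legendre l v) u = 0 := by
  -- Lifting `u` to a vector at `v` reduces the claim to criticality of the pull-back of the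
  -- function to `TQ`.
  obtain ⟨z, hz⟩ := hsubm v u hu
  have hV₀ := fieldCoord_self hv
  have hx := mem_extChartAt_target (I := 𝓘(ℝ, E)) v.proj
  have hdef := hasFDerivAt_defect
    (L := fun z : E × E => localLagrangian l v.proj z.1 z.2)
    (C := fun z : E × E => fderiv ℝ (localLagrangian l v.proj z.1) z.2)
    (differentiableAt_fieldCoord hv)
    (by rw [hV₀]; exact (contDiffAt_localLagrangian hl hx _).differentiableAt (by simp))
    (by rw [hV₀]; exact (contDiffAt_fderiv_localLagrangian hl hx _).differentiableAt (by simp))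
    (by
      rw [hV₀]
      intro a
      rw [fderiv_localLagrangian_apply hl hx, map_zero, zero_add])
  let G : CotangentBundle E Q → ℝ := fun ξ => pairing l q₀ (velocityCoord q₀ v) ξ - h ξ
  have hcont := FiberBundle.continuous_proj E (TangentSpace 𝓘(ℝ, E) : Q → Type _)
  -- Replacing `h ∘ 𝓛` by the energy turns the pull-back into the function of `hasFDerivAt_defect`.
  have hG : G ∘ legendre l =ᶠ[𝓝 v] fun w =>
      (fun z : E × E => fderiv ℝ (localLagrangian l v.proj z.1) z.2
          (fieldCoord q₀ v.proj (velocityCoord q₀ v) z.1 - z.2) -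
        localLagrangian l v.proj z.1 (fieldCoord q₀ v.proj (velocityCoord q₀ v) z.1) +
        localLagrangian l v.proj z.1 z.2) (extChartAt 𝓘(ℝ, E).tangent v w) := by
    filter_upwards [hcont.continuousAt.eventually_mem
      ((chartAt E v.proj).open_source.mem_nhds (mem_chart_source E v.proj))] with w hw
    have h1 : G (legendre l w) = pairing l q₀ (velocityCoord q₀ v) (legendre l w) -
      h (legendre l w) := rfl
    rw [Function.comp, h1, hh, energy_eq hw, pairing_eq (q := v.proj) l q₀ _ hw,
      momentumCoord_legendre hl hw, extChartAt_tangent, map_sub]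
    simp only [legendre]
    ring
  have h0 : differential 𝓘(ℝ, E).tangent (G ∘ legendre l) v = 0 :=
    differential_eq_of_hasFDerivAt (by rw [extChartAt_tangent, ← hV₀]; exact hdef) hG
  have hGd : MDifferentiableAt (cotangentModel E) 𝓘(ℝ, ℝ) G (legendre l v) := by
    have h1 := contMDiffAt_pairing hl (w := fun _ => velocityCoord q₀ v) (t := 0)
      contDiffAt_const (ξ := legendre l v) hv
    have h2 := ContMDiffAt.comp (f := fun ξ : CotangentBundle E Q => ((0 : ℝ), ξ))
      (legendre l v) h1 (contMDiffAt_const.prodMk contMDiffAt_id)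
    exact (h2.sub h.contMDiff.contMDiffAt).mdifferentiableAt (by simp)
  have hleg : MDifferentiableAt 𝓘(ℝ, E).tangent (cotangentModel E) (legendre l) v :=
    (contMDiff_legendre hl).mdifferentiable (by simp) v
  have hcomp := (hGd.hasMFDerivAt.comp v hleg.hasMFDerivAt).mfderiv
  have h3 : differential 𝓘(ℝ, E).tangent (G ∘ legendre l) v z =
      differential (cotangentModel E) G (legendre l v)
        (mfderiv 𝓘(ℝ, E).tangent (cotangentModel E) (legendre l) v z) :=
    congrArg (fun L : E × E →L[ℝ] ℝ => L z) hcomp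
  rw [h0, hz] at h3
  exact h3.symm

/-- In the chart at `γ t`, the curve `s ↦ 𝓛(γ'(s))` has at `t` the velocity `(x', ∂L/∂x)`. -/
theorem hasMFDerivAt_legendre_firstJet {γ : ℝ → Q} {J : Set ℝ} (hJ : IsOpen J)
    (hγ : ContMDiffOn 𝓘(ℝ, ℝ) 𝓘(ℝ, E) ∞ γ J) (hEL : SatisfiesEulerLagrangeOn l γ J)
    {t : ℝ} (ht : t ∈ J) :
    HasMFDerivAt 𝓘(ℝ, ℝ) (cotangentModel E) (fun s => legendre l (firstJet γ s)) t
      ((1 : ℝ →L[ℝ] ℝ).smulRight ((velocityCoord (γ t) (firstJet γ t),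
        fderiv ℝ (fun y => localLagrangian l (γ t) y (velocityCoord (γ t) (firstJet γ t)))
          (extChartAt 𝓘(ℝ, E) (γ t) (γ t))) : E × (E →L[ℝ] ℝ))) := by
  have hc : ContMDiffAt 𝓘(ℝ, ℝ) (cotangentModel E) ∞ (fun s => legendre l (firstJet γ s)) t :=
    (contMDiff_legendre hl).contMDiffAt.comp t (contMDiffAt_firstJet hJ hγ ht)
  have hγt := hγ.contMDiffAt (hJ.mem_nhds ht)
  let x : ℝ → E := fun s => extChartAt 𝓘(ℝ, E) (γ t) (γ s)
  have hx : ContDiffAt ℝ ∞ x t :=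
    contMDiffAt_iff_contDiffAt.1 (contMDiffAt_extChartAt.comp t hγt)
  have hv : velocityCoord (γ t) (firstJet γ t) = deriv x t :=
    velocityCoord_firstJet (hγt.mdifferentiableAt (by simp)) (mem_chart_source E (γ t))
  -- The Euler-Lagrange equations give the derivative of the momentum component `∂L/∂v` along the
  -- curve.
  have h1 := hEL t ht (γ t) (mem_chart_source E (γ t))
  have h2 : HasDerivAt x (deriv x t) t := (hx.differentiableAt (by simp)).hasDerivAt
  let Φ : ℝ → E × (E →L[ℝ] ℝ) := fun s =>
    extChartAt (cotangentModel E) (legendre l (firstJet γ t)) (legendre l (firstJet γ s))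
  have h4 : Φ =ᶠ[𝓝 t]
      fun s => (x s, fderiv ℝ (fun v => localLagrangian l (γ t) (x s) v) (deriv x s)) := by
    filter_upwards [hJ.mem_nhds ht, hγt.continuousAt.eventually_mem
      ((chartAt E (γ t)).open_source.mem_nhds (mem_chart_source E (γ t)))] with s hs hsq
    have h5 := momentumCoord_legendre hl (v := firstJet γ s) hsq
    rw [velocityCoord_firstJet ((hγ.contMDiffAt (hJ.mem_nhds hs)).mdifferentiableAt (by simp))
      hsq] at h5
    exact (extChartAt_cotangent _ _).trans (Prod.ext rfl h5)
  have h6 := ((h2.prodMk h1).congr_of_eventuallyEq h4).hasFDerivAt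
  have h7 : ContinuousLinearMap.toSpanSingleton ℝ (deriv x t,
      fderiv ℝ (fun y => localLagrangian l (γ t) y (deriv x t)) (x t)) =
      (1 : ℝ →L[ℝ] ℝ).smulRight (deriv x t,
        fderiv ℝ (fun y => localLagrangian l (γ t) y (deriv x t)) (x t)) := by
    ext1; simp
  rw [hv]
  refine ⟨hc.continuousAt, ?_⟩
  exact (h6.congr_fderiv h7).hasFDerivWithinAt

end Pairing

section Main

variable {E : Type*} [NormedAddCommGroup E] [NormedSpace ℝ E]
  {Q : Type*} [TopologicalSpace Q] [ChartedSpace E Q] [IsManifold 𝓘(ℝ, E) ∞ Q]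

/-! ### The Lagrange multipliers of a solution of the Euler-Lagrange equations -/

/-- The velocity of the curve `t ↦ 𝓛(γ'(t))` prescribed by the Euler-Lagrange equations, in the
chart at `γ t`. -/
def eulerLagrangeVelocity (l : TangentBundle 𝓘(ℝ, E) Q → ℝ) (γ : ℝ → Q) (t : ℝ) :
    E × (E →L[ℝ] ℝ) :=
  (velocityCoord (γ t) (firstJet γ t),
    fderiv ℝ (fun y => localLagrangian l (γ t) y (velocityCoord (γ t) (firstJet γ t)))
      (extChartAt 𝓘(ℝ, E) (γ t) (γ t)))

theorem differential_total {k : ℕ} (h : SmoothFunctions E Q) (p : Fin k → SmoothFunctions E Q)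
    (c : Fin k → ℝ) (ξ : CotangentBundle E Q) :
    differential (cotangentModel E) (h + ∑ i, c i • p i : SmoothFunctions E Q) ξ =
      differential (cotangentModel E) h ξ + ∑ i, c i • differential (cotangentModel E) (p i) ξ := by
  have hp : ∀ i, HasMFDerivAt (cotangentModel E) 𝓘(ℝ, ℝ) (p i) ξ
      (differential (cotangentModel E) (p i) ξ) := fun i =>
    ((p i).contMDiff.mdifferentiable (by simp) ξ).hasMFDerivAt
  have h1 : HasMFDerivAt (cotangentModel E) 𝓘(ℝ, ℝ) h ξ (differential (cotangentModel E) h ξ) :=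
    (h.contMDiff.mdifferentiable (by simp) ξ).hasMFDerivAt
  have h2 := h1.add (HasMFDerivAt.sum (t := Finset.univ) (f := fun i => c i • (p i : _ → ℝ))
    (f' := fun i => (c i • differential (cotangentModel E) (p i) ξ : E × (E →L[ℝ] ℝ) →L[ℝ] ℝ))
    fun i _ => (hp i).const_smul (c i))
  have h3 : ((h + ∑ i, c i • p i : SmoothFunctions E Q) : CotangentBundle E Q → ℝ) =
      h + ∑ i, c i • (p i : CotangentBundle E Q → ℝ) := by
    ext η
    have h4 := map_sum (ContMDiffMap.evalRingHom (I := cotangentModel E) (I' := 𝓘(ℝ, ℝ))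
      (n := ∞) η) (fun i => c i • p i) Finset.univ
    have h5 : (∑ i, c i • p i : SmoothFunctions E Q) η = ∑ i, c i * p i η := h4
    simp [h5]
  rw [h3]
  exact h2.mfderiv

variable {l : TangentBundle 𝓘(ℝ, E) Q → ℝ} (hl : ContMDiff 𝓘(ℝ, E).tangent 𝓘(ℝ, ℝ) ∞ l)
include hl

/-- For `u = (x', ∂L/∂x)` the coordinate formula for `ω` gives `-ω(u, (b, β)) = β x' - (∂L/∂x) b`,
which is the differential of `pairing`. -/
theorem differential_pairing_sub_eq_symplecticForm (h : SmoothFunctions E Q) {γ : ℝ → Q} {t : ℝ}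
    {q₀ : Q} (hq : γ t ∈ (chartAt E q₀).source) (w : E × (E →L[ℝ] ℝ)) :
    differential (cotangentModel E)
        (fun ξ => pairing l q₀ (velocityCoord q₀ (firstJet γ t)) ξ - h ξ)
        (legendre l (firstJet γ t)) w =
      -symplecticForm (legendre l (firstJet γ t)) (eulerLagrangeVelocity l γ t) w -
        differential (cotangentModel E) h (legendre l (firstJet γ t)) w := by
  let G : CotangentBundle E Q → ℝ := pairing l q₀ (velocityCoord q₀ (firstJet γ t))
  have hG : MDifferentiableAt (cotangentModel E) 𝓘(ℝ, ℝ) G (legendre l (firstJet γ t)) := by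
    have h1 := contMDiffAt_pairing hl (w := fun _ => velocityCoord q₀ (firstJet γ t)) (t := 0)
      contDiffAt_const (ξ := legendre l (firstJet γ t)) hq
    have h2 := ContMDiffAt.comp (f := fun ξ : CotangentBundle E Q => ((0 : ℝ), ξ))
      (legendre l (firstJet γ t)) h1 (contMDiffAt_const.prodMk contMDiffAt_id)
    exact h2.mdifferentiableAt (by simp)
  have hh : MDifferentiableAt (cotangentModel E) 𝓘(ℝ, ℝ) h (legendre l (firstJet γ t)) :=
    h.contMDiff.mdifferentiable (by simp) _
  have h3 : differential (cotangentModel E) (fun ξ => G ξ - h ξ) (legendre l (firstJet γ t)) =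
      differential (cotangentModel E) G (legendre l (firstJet γ t)) -
        differential (cotangentModel E) h (legendre l (firstJet γ t)) :=
    (hG.hasMFDerivAt.sub hh.hasMFDerivAt).mfderiv
  have h4 := differential_pairing hl (v := firstJet γ t) hq w.1 w.2
  have h5 := symplecticForm_eq (legendre l (firstJet γ t)) (eulerLagrangeVelocity l γ t) w
  refine (congrArg (fun A : E × (E →L[ℝ] ℝ) →L[ℝ] ℝ => A w) h3).trans ?_
  rw [h5]
  refine congrArg (· - _) (h4.trans ?_)
  exact (neg_sub _ _).symm

/-- The `dp_i` may be linearly dependent, so multipliers need not be unique and local solutions need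
not agree on overlaps; being solutions of affine equations, they can be averaged. -/
theorem exists_multipliers [FiniteDimensional ℝ E] [T2Space Q]
    (hPsub : IsEmbeddedSubmanifold (cotangentModel E) (primaryConstraintSet l))
    (hsubm : IsLegendreSubmersion l) (h : SmoothFunctions E Q)
    (hh : ∀ v, h (legendre l v) = energy l v) {k : ℕ} (p : Fin k → SmoothFunctions E Q)
    (hp : Ideal.span (Set.range p) = primaryConstraints l)
    {J : Set ℝ} (hJ : IsOpen J) {γ : ℝ → Q} (hγ : ContMDiffOn 𝓘(ℝ, ℝ) 𝓘(ℝ, E) ∞ γ J) :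
    ∃ lam : ℝ → Fin k → ℝ, ContDiffOn ℝ ∞ lam J ∧ ∀ t ∈ J, ∀ w : E × (E →L[ℝ] ℝ),
      symplecticForm (legendre l (firstJet γ t)) (eulerLagrangeVelocity l γ t) w =
        -(differential (cotangentModel E) h (legendre l (firstJet γ t)) w +
          ∑ i, lam t i * differential (cotangentModel E) (p i) (legendre l (firstJet γ t)) w) := by
  have : T2Space (CotangentBundle E Q) := t2Space_totalSpace
  refine exists_contDiffOn_forall_mem_convex hJ
    (C := fun t => {c : Fin k → ℝ | ∀ w : E × (E →L[ℝ] ℝ),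
      symplecticForm (legendre l (firstJet γ t)) (eulerLagrangeVelocity l γ t) w =
        -(differential (cotangentModel E) h (legendre l (firstJet γ t)) w +
          ∑ i, c i * differential (cotangentModel E) (p i) (legendre l (firstJet γ t)) w)})
    (fun t => ?_) fun t₀ ht₀ => ?_
  · intro c hc d hd a b _ _ hab w
    have h1 : ∑ i, (a • c + b • d) i *
        differential (cotangentModel E) (p i) (legendre l (firstJet γ t)) w =
        a * ∑ i, c i * differential (cotangentModel E) (p i) (legendre l (firstJet γ t)) w +
        b * ∑ i, d i * differential (cotangentModel E) (p i) (legendre l (firstJet γ t)) w := by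
      rw [Finset.mul_sum, Finset.mul_sum, ← Finset.sum_add_distrib]
      refine Finset.sum_congr rfl fun i _ => ?_
      simp
      ring
    have hb : b = 1 - a := by linarith
    have hc' := hc w
    have hd' := hd w
    rw [h1, hb]
    linear_combination a * hc' + (1 - a) * hd'
  · have hγt : ∀ t ∈ J, ContMDiffAt 𝓘(ℝ, ℝ) 𝓘(ℝ, E) ∞ γ t := fun t ht =>
      hγ.contMDiffAt (hJ.mem_nhds ht)
    have hq : ∀ᶠ t in 𝓝 t₀, γ t ∈ (chartAt E (γ t₀)).source :=
      (hγt t₀ ht₀).continuousAt.eventually_mem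
        ((chartAt E (γ t₀)).open_source.mem_nhds (mem_chart_source E (γ t₀)))
    obtain ⟨lam, hlam⟩ := exists_multipliers_near hPsub p
      (fun i x hx => by
        have : p i ∈ primaryConstraints l := hp ▸ Ideal.subset_span ⟨i, rfl⟩
        exact this x hx)
      (fun g hg => by rw [hp]; exact hg)
      (c := fun t => legendre l (firstJet γ t)) (fun t => ⟨_, rfl⟩) (t₀ := t₀)
      (by
        filter_upwards [hJ.mem_nhds ht₀] with t ht
        exact (contMDiff_legendre hl).contMDiffAt.comp t (contMDiffAt_firstJet hJ hγ ht))
      -- The chart is frozen at `γ t₀`; only the constant vector varies with `t`.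
      (fun t ξ => pairing l (γ t₀) (velocityCoord (γ t₀) (firstJet γ t)) ξ - h ξ)
      (by
        filter_upwards [hJ.mem_nhds ht₀, hq] with t ht hqt
        have h1 : ContDiffAt ℝ ∞ (fun s => extChartAt 𝓘(ℝ, E) (γ t₀) (γ s)) t :=
          contMDiffAt_iff_contDiffAt.1 ((contMDiffAt_extChartAt' hqt).comp t (hγt t ht))
        have h2 : ContDiffAt ℝ ∞ (deriv fun s => extChartAt 𝓘(ℝ, E) (γ t₀) (γ s)) t :=
          (h1.fderiv_right (m := ∞) (by simp)).clm_apply contDiffAt_const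
        have h3 : ContDiffAt ℝ ∞ (fun s => velocityCoord (γ t₀) (firstJet (E := E) γ s)) t := by
          refine h2.congr_of_eventuallyEq ?_
          filter_upwards [hJ.mem_nhds ht, (hγt t ht).continuousAt.eventually_mem
            ((chartAt E (γ t₀)).open_source.mem_nhds hqt)] with s hs hsq
          exact velocityCoord_firstJet ((hγt s hs).mdifferentiableAt (by simp)) hsq
        have h4 := contMDiffAt_pairing hl h3 (ξ := legendre l (firstJet γ t)) hqt
        exact h4.sub (h.contMDiff.contMDiffAt.comp _ contMDiffAt_snd))
      (by
        filter_upwards [hq] with t hqt u hu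
        exact differential_pairing_sub_eq_zero hl hsubm hh (v := firstJet γ t) hqt hu)
    refine ⟨lam, ?_⟩
    filter_upwards [hlam, hq] with t ht hqt
    refine ⟨ht.1, fun w => ?_⟩
    have h1 := ht.2 w
    rw [differential_pairing_sub_eq_symplecticForm hl h hqt] at h1
    linarith

end Main

end DiracConstraint

end

/-! ### Assembly of the Hamiltonian vector field. -/

theorem mainTheorem5
    {E : Type*} [NormedAddCommGroup E] [NormedSpace ℝ E] [FiniteDimensional ℝ E]
    {Q : Type*} [TopologicalSpace Q] [T2Space Q] [ChartedSpace E Q] [IsManifold 𝓘(ℝ, E) ∞ Q]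
    (l : TangentBundle 𝓘(ℝ, E) Q → ℝ) (hl : ContMDiff 𝓘(ℝ, E).tangent 𝓘(ℝ, ℝ) ∞ l)
    (hPclosed : IsClosed (DiracConstraint.primaryConstraintSet l))
    (hPsub : DiracConstraint.IsEmbeddedSubmanifold (DiracConstraint.cotangentModel E)
      (DiracConstraint.primaryConstraintSet l))
    (hsubm : DiracConstraint.IsLegendreSubmersion l)
    (h : DiracConstraint.SmoothFunctions E Q)
    (hh : ∀ v, h (DiracConstraint.legendre l v) = DiracConstraint.energy l v)
    {k : ℕ} (p : Fin k → DiracConstraint.SmoothFunctions E Q)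
    (hp : Ideal.span (Set.range p) = DiracConstraint.primaryConstraints l)
    {J : Set ℝ} (hJ : IsOpen J) (γ : ℝ → Q) (hγ : ContMDiffOn 𝓘(ℝ, ℝ) 𝓘(ℝ, E) ∞ γ J)
    (hEL : DiracConstraint.SatisfiesEulerLagrangeOn l γ J) :
    ∃ (lam : Fin k → ℝ → ℝ)
      (X : ℝ → ∀ ξ : DiracConstraint.CotangentBundle E Q,
        TangentSpace (DiracConstraint.cotangentModel E) ξ),
      (∀ i, ContDiffOn ℝ ∞ (lam i) J) ∧
      (∀ t, DiracConstraint.IsHamiltonianVectorField (h + ∑ i, lam i t • p i) (X t)) ∧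
      DiracConstraint.IsTimeDepIntegralCurveOn (DiracConstraint.cotangentModel E)
        (fun t => DiracConstraint.legendre l (DiracConstraint.firstJet γ t)) X J := by
  obtain ⟨lam, hlam, hsol⟩ := DiracConstraint.exists_multipliers hl hPsub hsubm h hh p hp hJ hγ
  have hX : ∀ (t : ℝ) (ξ : DiracConstraint.CotangentBundle E Q), ∃ u : E × (E →L[ℝ] ℝ),
      (∀ w : E × (E →L[ℝ] ℝ), DiracConstraint.symplecticForm ξ u w =
        -DiracConstraint.differential (DiracConstraint.cotangentModel E)
          (h + ∑ i, lam t i • p i : DiracConstraint.SmoothFunctions E Q) ξ w) ∧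
      (t ∈ J → ξ = DiracConstraint.legendre l (DiracConstraint.firstJet γ t) →
        u = DiracConstraint.eulerLagrangeVelocity l γ t) := by
    intro t ξ
    -- On the curve the Hamiltonian vector is chosen to be the Euler-Lagrange velocity; elsewhere
    -- any solution of `ω(u, ·) = -d(h + ∑ λ_i p_i)` will do, so uniqueness is not needed.
    by_cases hξ : t ∈ J ∧ ξ = DiracConstraint.legendre l (DiracConstraint.firstJet γ t)
    · obtain ⟨ht, rfl⟩ := hξ
      refine ⟨_, fun w => ?_, fun _ _ => rfl⟩
      rw [hsol t ht w, DiracConstraint.differential_total]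
      simp
    · obtain ⟨u, hu⟩ := DiracConstraint.exists_symplecticForm_eq ξ
        (DiracConstraint.differential (DiracConstraint.cotangentModel E)
          (h + ∑ i, lam t i • p i : DiracConstraint.SmoothFunctions E Q) ξ)
      exact ⟨u, hu, fun ht h' => absurd ⟨ht, h'⟩ hξ⟩
  choose X hX1 hX2 using hX
  refine ⟨fun i t => lam t i, X, fun i => contDiffOn_pi.1 hlam i, fun t ξ w => hX1 t ξ w,
    fun t ht => ?_⟩
  have h1 := DiracConstraint.hasMFDerivAt_legendre_firstJet hl hJ hγ hEL ht
  have h2 : X t (DiracConstraint.legendre l (DiracConstraint.firstJet γ t)) = _ := hX2 t _ ht rfl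
  beta_reduce
  rw [h2]
  exact h1
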